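/- Let $S,T>0$ and $R_{ST}=[0,S]\times[0,T]$. A standard Brownian sheet is a centered Gaussian random field $B=\{B(s,t)\}_{s,t\ge 0}$ with $\mathbb E[B(s_1,t_1)B(s_2,t_2)]=(s_1\wedge s_2)(t_1\wedge t_2)$ and almost surely continuous paths. On a probability space, let for every integer $d\ge 1$ a family $\{b^d_{ij}(s,t):s,t\ge 0\}_{1\le i\le j\le d}$ of random fields be given such that each $b^d_{ij}(0,0)$ is a (deterministic or random) real initial value and the fields $b^d_{ij}(s,t)-b^d_{ij}(0,0)$, $1\le i\le j\le d$, are independent standard Brownian sheets. Let $X^d(s,t)$ be the symmetric $d\times d$ matrix with entries $X^d_{ij}(s,t)=b^d_{ij}(s,t)$ for $i<j$ and $X^d_{ii}(s,t)=\sqrt2\,b^d_{ii}(s,t)$, let $\lambda^d_1(s,t),\dots,\lambda^d_d(s,t)$ be its eigenvalues (with multiplicity), and let $$L_d(s,t)=\frac1d\sum_{i=1}^d\delta_{\lambda_i^d(s,t)/\sqrt d}$$ be the empirical spectral measure of $X^d(s,t)/\sqrt d$; write $\langle f,\mu\rangle=\int_{\mathbb R} f\,d\mu$. Let $\mathcal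 P(\mathbb R)$ be the set of probability measures on $\mathbb R$ with the weak topology, and give $C(R_{ST},\mathcal P(\mathbb R))$ the topology of uniform convergence and its Borel $\sigma$-algebra. Theorem. Assume that there is a nonnegative function $\varphi\in C^1(\mathbb R)$ with bounded derivative such that $$\lim_{|x|\to\infty}\varphi(x)=+\infty\qquad\text{and}\qquad \sup_{d\ge 1}\,\langle\varphi,L_d(0,0)\rangle<\infty\quad\text{almost surely}.$$ Then, after modification on null events, each $\{L_d(s,t)\}_{(s,t)\in R_{ST}}$ is a random element of $C(R_{ST},\mathcal P(\mathbb R))$, and the sequence of these random elements is tight: for every $\varepsilon>0$ there is a compact set $K\subset C(R_{ST},\mathcal P(\mathbb R))$ such that $\mathbb P(L_d\notin K)\le\varepsilon$ for all $d\ge1$. -/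

import Mathlib

open MeasureTheory ProbabilityTheory Filter Topology
open scoped NNReal ENNReal

/-- `B` is a standard one-dimensional Brownian sheet on `[0,∞) × [0,∞)` under `P`: a centered
Gaussian random field with covariance `(s₁ ∧ s₂) (t₁ ∧ t₂)` and almost surely continuous paths. -/
structure IsBrownianSheet {Ω : Type*} [MeasurableSpace Ω] (B : ℝ≥0 × ℝ≥0 → Ω → ℝ)
    (P : Measure Ω) : Prop where
  gaussian : IsGaussianProcess B P
  centered : ∀ z, ∫ ω, B z ω ∂P = 0
  covariance : ∀ z w,
    ∫ ω, B z ω * B w ω ∂P = (min (z.1 : ℝ) (w.1 : ℝ)) * (min (z.2 : ℝ) (w.2 : ℝ))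
  continuous_paths : ∀ᵐ ω ∂P, Continuous fun z => B z ω

/-- The symmetric matrix with entries `b i j` for `i < j` and `√2 * b i i` on the diagonal. Only the
values `b i j` with `i ≤ j` are used. -/
noncomputable def symmMatrix {n : ℕ} (b : Fin n → Fin n → ℝ) : Matrix (Fin n) (Fin n) ℝ :=
  Matrix.of fun i j => if i = j then √2 * b i i else b (min i j) (max i j)

theorem symmMatrix_isHermitian {n : ℕ} (b : Fin n → Fin n → ℝ) :
    (symmMatrix b).IsHermitian := by
  ext i j
  by_cases h : i = j
  · subst h; simp [symmMatrix]
  · simp [symmMatrix, h, Ne.symm h, min_comm, max_comm]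

/-- The empirical spectral measure of `A / √n` for a real symmetric `n × n` matrix `A` with
eigenvalues `λ₁, …, λₙ` (listed with multiplicity): the measure `(1/n) ∑ᵢ δ_{λᵢ / √n}`. -/
noncomputable def rescaledSpectralMeasure {n : ℕ} [NeZero n] {A : Matrix (Fin n) (Fin n) ℝ}
    (hA : A.IsHermitian) : ProbabilityMeasure ℝ :=
  ⟨(n : ℝ≥0∞)⁻¹ • ∑ i : Fin n, Measure.dirac (hA.eigenvalues i / √(n : ℝ)), ⟨by
    have hn : (n : ℝ≥0∞) ≠ 0 := by exact_mod_cast NeZero.ne n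
    simp [ENNReal.inv_mul_cancel hn (ENNReal.natCast_ne_top n)]⟩⟩

/-- The random measure `L_d(z)`: the empirical spectral measure of `X^d(z) / √d`, where `X^d(z)` is
the symmetric matrix built from the values `b i j z`, `i ≤ j`. -/
noncomputable def sheetSpectralMeasure {Ω : Type*} {d : ℕ+}
    (b : Fin d → Fin d → ℝ≥0 × ℝ≥0 → Ω → ℝ) (z : ℝ≥0 × ℝ≥0) (ω : Ω) : ProbabilityMeasure ℝ :=
  rescaledSpectralMeasure (symmMatrix_isHermitian fun i j => b i j z ω)

/-- The rectangle `[0,S] × [0,T]`, as an interval for the componentwise order. -/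
abbrev Rect (S T : ℝ≥0) : Set (ℝ≥0 × ℝ≥0) := Set.Icc (0, 0) (S, T)

/-- The space `C([0,S] × [0,T], 𝓟(ℝ))` of continuous maps from the rectangle to the probability
measures on `ℝ` with their weak topology. Its topology is the compact-open one, that is, the
topology of uniform convergence. -/
abbrev MeasurePaths (S T : ℝ≥0) : Type := C(Rect S T, ProbabilityMeasure ℝ)

/-- `MeasurePaths S T` carries its Borel σ-algebra. -/
noncomputable instance MeasurePaths.instMeasurableSpace (S T : ℝ≥0) : MeasurableSpace (MeasurePaths S T) :=
  borel _

instance MeasurePaths.instBorelSpace (S T : ℝ≥0) : BorelSpace (MeasurePaths S T) := ⟨rfl⟩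

/-!
The spectral measures are controlled pathwise by the matrix field `X(z) / d`, regarded as a field
in Euclidean space. For symmetric `A` and `B` with orthonormal eigenbases `(uᵢ)`, `(vⱼ)`, the numbers
`⟨uᵢ, vⱼ⟩²` couple the two spectra, and the quadratic cost of this coupling is the squared Frobenius
distance (`exists_spectral_coupling`). Hence, with `r = ‖A - B‖_F / d`, integrals of `C`-Lipschitz
functions against the two spectral measures differ by at most `C r`, and the Lévy–Prokhorov distance
is at most `ε` as soon as `r ≤ ε ^ 2`.

It remains to bound the modulus of continuity of `X(z) / d` uniformly in `d`. By Jensen's inequality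
the sixth moment of an increment is at most eight times that of a Brownian sheet, which is Gaussian,
and a dyadic chaining argument (`edist_le_of_dist_le`, `lintegral_tsum_stepBound_le`) gives a modulus
whose expectation tends to `0` at a rate independent of `d`. Initial values cancel in increments, and
only the law of each single entry matters.

So, outside an event of small probability that is uniform in `d`, all paths lie in one set
`controlledPaths`: the bound on `∫ φ` at the origin propagates to the whole rectangle because `φ` is
Lipschitz, and the modulus passes to the Lévy–Prokhorov distance (`mem_controlledPaths`). This set is
compact by the theorems of Prokhorov and Arzelà–Ascoli (`isCompact_controlledPaths`).

Measurability of the paths: the entries form a random element of a space of continuous functions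
(`exists_measurable_continuousMap`), and the spectral measure is a continuous function of the
entries (`continuous_spectralMeasureOf`).
-/

/-! ### Coupling of the spectra of two symmetric matrices -/

/-- The squared overlaps `⟨uᵢ, vⱼ⟩²` of two orthonormal eigenbases form a doubly stochastic matrix,
and it couples the two spectra with quadratic cost equal to the squared Frobenius distance. This
replaces the Hoffman–Wielandt inequality: no optimal matching of the eigenvalues is needed. -/
theorem exists_spectral_coupling {n : ℕ} {A B : Matrix (Fin n) (Fin n) ℝ}
    (hA : A.IsHermitian) (hB : B.IsHermitian) :
    ∃ p : Fin n → Fin n → ℝ, (∀ i j, 0 ≤ p i j) ∧ (∀ i, ∑ j, p i j = 1) ∧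
      (∀ j, ∑ i, p i j = 1) ∧
      ∑ i, ∑ j, p i j * (hA.eigenvalues i - hB.eigenvalues j) ^ 2 =
        ∑ i, ∑ j, (A i j - B i j) ^ 2 := by
  set U : Matrix (Fin n) (Fin n) ℝ := hA.eigenvectorUnitary.1 with hU
  set V : Matrix (Fin n) (Fin n) ℝ := hB.eigenvectorUnitary.1 with hV
  have hU1 : U.transpose * U = 1 := by
    simpa [Matrix.star_eq_conjTranspose] using Unitary.coe_star_mul_self hA.eigenvectorUnitary
  have hU2 : U * U.transpose = 1 := by
    simpa [Matrix.star_eq_conjTranspose] using Unitary.coe_mul_star_self hA.eigenvectorUnitary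
  have hV1 : V.transpose * V = 1 := by
    simpa [Matrix.star_eq_conjTranspose] using Unitary.coe_star_mul_self hB.eigenvectorUnitary
  have hV2 : V * V.transpose = 1 := by
    simpa [Matrix.star_eq_conjTranspose] using Unitary.coe_mul_star_self hB.eigenvectorUnitary
  have hAs : U.transpose * A = Matrix.diagonal hA.eigenvalues * U.transpose := by
    have h := hA.spectral_theorem
    rw [Unitary.conjStarAlgAut_apply] at h
    have h' : A = U * Matrix.diagonal hA.eigenvalues * U.transpose := by
      simpa [Matrix.star_eq_conjTranspose, Function.comp_def] using h
    nth_rewrite 1 [h']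
    rw [← mul_assoc, ← mul_assoc, hU1, one_mul]
  have hBs : B * V = V * Matrix.diagonal hB.eigenvalues := by
    have h := hB.spectral_theorem
    rw [Unitary.conjStarAlgAut_apply] at h
    have h' : B = V * Matrix.diagonal hB.eigenvalues * V.transpose := by
      simpa [Matrix.star_eq_conjTranspose, Function.comp_def] using h
    nth_rewrite 1 [h']
    rw [mul_assoc, hV1, mul_one]
  have trace_mul_transpose : ∀ M : Matrix (Fin n) (Fin n) ℝ,
      (M * M.transpose).trace = ∑ i, ∑ j, M i j ^ 2 := fun M => by
    simp [Matrix.trace, Matrix.mul_apply, sq]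
  set W := U.transpose * V with hW
  have hW1 : W * W.transpose = 1 := by
    rw [hW, Matrix.transpose_mul, Matrix.transpose_transpose, mul_assoc, ← mul_assoc V, hV2,
      one_mul, hU1]
  have hW2 : W.transpose * W = 1 := by
    rw [hW, Matrix.transpose_mul, Matrix.transpose_transpose, mul_assoc, ← mul_assoc U, hU2,
      one_mul, hV1]
  have hdiff : U.transpose * (A - B) * V
      = Matrix.diagonal hA.eigenvalues * W - W * Matrix.diagonal hB.eigenvalues := by
    rw [mul_sub, sub_mul, hAs, mul_assoc, mul_assoc, mul_assoc, hBs]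
  refine ⟨fun i j => W i j ^ 2, fun i j => sq_nonneg _, fun i => ?_, fun j => ?_, ?_⟩
  · simpa [Matrix.mul_apply, sq] using congr_fun (congr_fun hW1 i) i
  · simpa [Matrix.mul_apply, sq] using congr_fun (congr_fun hW2 j) j
  · -- The Frobenius norm is invariant under the orthogonal matrices `Uᵀ` and `V`.
    have h1 : ((U.transpose * (A - B) * V) * (U.transpose * (A - B) * V).transpose).trace
        = ((A - B) * (A - B).transpose).trace := by
      rw [Matrix.transpose_mul, Matrix.transpose_mul, Matrix.transpose_transpose,
        mul_assoc, ← mul_assoc V, hV2, one_mul, Matrix.trace_mul_comm, mul_assoc,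
        ← mul_assoc U, hU2, one_mul, Matrix.trace_mul_comm]
    rw [trace_mul_transpose, trace_mul_transpose, hdiff] at h1
    simp only [Matrix.sub_apply] at h1
    rw [← h1]
    refine Finset.sum_congr rfl fun i _ => Finset.sum_congr rfl fun j _ => ?_
    simp only [Matrix.diagonal_mul, Matrix.mul_diagonal]
    ring

theorem integrable_rescaledSpectralMeasure {n : ℕ} [NeZero n] {A : Matrix (Fin n) (Fin n) ℝ}
    (hA : A.IsHermitian) (f : ℝ → ℝ) :
    Integrable f (rescaledSpectralMeasure hA : Measure ℝ) := by
  change Integrable f ((n : ℝ≥0∞)⁻¹ • ∑ i : Fin n, Measure.dirac _)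
  refine Integrable.smul_measure ?_ (by simp [NeZero.ne n])
  rw [integrable_finsetSum_measure]
  exact fun i _ => integrable_dirac (by simp)

theorem integral_rescaledSpectralMeasure {n : ℕ} [NeZero n] {A : Matrix (Fin n) (Fin n) ℝ}
    (hA : A.IsHermitian) (f : ℝ → ℝ) :
    ∫ x, f x ∂(rescaledSpectralMeasure hA : Measure ℝ)
      = (n : ℝ)⁻¹ * ∑ i, f (hA.eigenvalues i / √(n : ℝ)) := by
  change ∫ x, f x ∂((n : ℝ≥0∞)⁻¹ • ∑ i : Fin n, Measure.dirac _) = _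
  rw [integral_smul_measure, integral_finsetSum_measure]
  · simp
  · exact fun i _ => integrable_dirac (by simp)

/-- The entries of `A / n` as a point of Euclidean space, so that distances between such points are
Frobenius distances divided by `n`. One factor `√n` comes from the scaling of the eigenvalues, the
other one from averaging over them. -/
noncomputable def normalizedEntries {n : ℕ} (A : Matrix (Fin n) (Fin n) ℝ) :
    EuclideanSpace ℝ (Fin n × Fin n) :=
  WithLp.toLp 2 fun p => A p.1 p.2 / n

theorem dist_normalizedEntries_sq {n : ℕ} (A B : Matrix (Fin n) (Fin n) ℝ) :
    dist (normalizedEntries A) (normalizedEntries B) ^ 2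
      = (∑ i, ∑ j, (A i j - B i j) ^ 2) / (n : ℝ) ^ 2 := by
  rw [EuclideanSpace.dist_eq, Real.sq_sqrt (Finset.sum_nonneg fun _ _ => sq_nonneg _),
    Fintype.sum_prod_type, Finset.sum_div]
  refine Finset.sum_congr rfl fun i _ => ?_
  rw [Finset.sum_div]
  refine Finset.sum_congr rfl fun j _ => ?_
  simp only [normalizedEntries, Real.dist_eq, sq_abs]
  ring

/-- Integrating a pointwise inequality with quadratic error against the spectral coupling. Both the
Lipschitz bound and the Lévy–Prokhorov bound below are instances. -/
theorem integral_rescaledSpectralMeasure_le {n : ℕ} [NeZero n] {A B : Matrix (Fin n) (Fin n) ℝ}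
    (hA : A.IsHermitian) (hB : B.IsHermitian) {f g : ℝ → ℝ} {a c : ℝ}
    (hfg : ∀ x y, f x ≤ g y + a + c * (x - y) ^ 2) :
    ∫ x, f x ∂(rescaledSpectralMeasure hA : Measure ℝ)
      ≤ ∫ x, g x ∂(rescaledSpectralMeasure hB : Measure ℝ) + a
        + c * dist (normalizedEntries A) (normalizedEntries B) ^ 2 := by
  obtain ⟨p, hp, hrow, hcol, hsum⟩ := exists_spectral_coupling hA hB
  have hn : (0 : ℝ) < n := by exact_mod_cast Nat.pos_of_ne_zero (NeZero.ne n)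
  rw [integral_rescaledSpectralMeasure, integral_rescaledSpectralMeasure,
    dist_normalizedEntries_sq, ← hsum]
  have hf : ∑ i, f (hA.eigenvalues i / √(n : ℝ))
      = ∑ i, ∑ j, p i j * f (hA.eigenvalues i / √(n : ℝ)) := by
    simp_rw [← Finset.sum_mul, hrow, one_mul]
  have hg : ∑ j, g (hB.eigenvalues j / √(n : ℝ))
      = ∑ i, ∑ j, p i j * g (hB.eigenvalues j / √(n : ℝ)) := by
    rw [Finset.sum_comm]
    simp_rw [← Finset.sum_mul, hcol, one_mul]
  have ha : (n : ℝ) * a = ∑ i, ∑ j, p i j * a := by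
    simp_rw [← Finset.sum_mul, hrow]
    simp
  have hle : ∑ i, f (hA.eigenvalues i / √(n : ℝ))
      ≤ ∑ j, g (hB.eigenvalues j / √(n : ℝ)) + n * a
        + c / n * ∑ i, ∑ j, p i j * (hA.eigenvalues i - hB.eigenvalues j) ^ 2 := by
    rw [hf, hg, ha, Finset.mul_sum, ← Finset.sum_add_distrib, ← Finset.sum_add_distrib]
    refine Finset.sum_le_sum fun i _ => ?_
    rw [Finset.mul_sum, ← Finset.sum_add_distrib, ← Finset.sum_add_distrib]
    refine Finset.sum_le_sum fun j _ => ?_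
    have h := mul_le_mul_of_nonneg_left
      (hfg (hA.eigenvalues i / √(n : ℝ)) (hB.eigenvalues j / √(n : ℝ))) (hp i j)
    rw [← sub_div, div_pow, Real.sq_sqrt hn.le] at h
    refine h.trans (le_of_eq ?_)
    ring
  have h := mul_le_mul_of_nonneg_left hle (inv_nonneg.2 hn.le)
  refine h.trans (le_of_eq ?_)
  field_simp

theorem integral_rescaledSpectralMeasure_le_of_lipschitzWith {n : ℕ} [NeZero n]
    {A B : Matrix (Fin n) (Fin n) ℝ} (hA : A.IsHermitian) (hB : B.IsHermitian)
    {f : ℝ → ℝ} {C : ℝ≥0} (hf : LipschitzWith C f) :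
    ∫ x, f x ∂(rescaledSpectralMeasure hA : Measure ℝ)
      ≤ ∫ x, f x ∂(rescaledSpectralMeasure hB : Measure ℝ)
        + C * dist (normalizedEntries A) (normalizedEntries B) := by
  set r := dist (normalizedEntries A) (normalizedEntries B) with hr
  have hr0 : 0 ≤ r := dist_nonneg
  -- The value `θ = r` is optimal, but `r` may vanish, so it is approached from above.
  have key : ∀ θ > r, ∫ x, f x ∂(rescaledSpectralMeasure hA : Measure ℝ)
      ≤ ∫ x, f x ∂(rescaledSpectralMeasure hB : Measure ℝ) + C * θ := fun θ hθ => by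
    have hθ0 : 0 < θ := hr0.trans_lt hθ
    -- Young's inequality `|t| ≤ θ / 2 + t² / (2 θ)` brings the Lipschitz bound to quadratic form.
    have h := integral_rescaledSpectralMeasure_le hA hB (f := f) (g := f) (a := C * (θ / 2))
      (c := C * (2 * θ)⁻¹) fun x y => by
        have h1 : f x ≤ f y + C * |x - y| := by
          have := hf.dist_le_mul x y
          rw [Real.dist_eq, Real.dist_eq] at this
          linarith [le_abs_self (f x - f y)]
        have h2 : |x - y| ≤ θ / 2 + (2 * θ)⁻¹ * (x - y) ^ 2 := by
          rw [← sq_abs (x - y)]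
          have : 0 ≤ (2 * θ)⁻¹ * (|x - y| - θ) ^ 2 := by positivity
          have e : (2 * θ)⁻¹ * (|x - y| - θ) ^ 2
            = θ / 2 + (2 * θ)⁻¹ * |x - y| ^ 2 - |x - y| := by field_simp; ring
          linarith
        have h3 := mul_le_mul_of_nonneg_left h2 C.coe_nonneg
        linarith
    refine h.trans ?_
    rw [← hr, add_assoc]
    have h4 : (2 * θ)⁻¹ * r ^ 2 ≤ θ / 2 := by
      rw [inv_mul_le_iff₀ (by positivity)]
      nlinarith
    have h5 := mul_le_mul_of_nonneg_left h4 C.coe_nonneg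
    linarith
  refine le_of_tendsto_of_tendsto (f := fun _ : ℝ => _) (b := 𝓝[>] r) tendsto_const_nhds
    (Tendsto.mono_left ?_ nhdsWithin_le_nhds) (eventually_nhdsWithin_of_forall key)
  exact (continuous_const.add (continuous_const.mul continuous_id)).tendsto' _ _ rfl

/-- Chebyshev's inequality for the spectral coupling: mass is moved farther than `δ > ε` with
probability at most `ε ^ 4 / δ ^ 2 ≤ δ`. -/
theorem levyProkhorovDist_rescaledSpectralMeasure_le {n : ℕ} [NeZero n]
    {A B : Matrix (Fin n) (Fin n) ℝ} (hA : A.IsHermitian) (hB : B.IsHermitian) {ε : ℝ}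
    (hε : 0 < ε) (hε1 : ε ≤ 1)
    (h : dist (normalizedEntries A) (normalizedEntries B) ≤ ε ^ 2) :
    levyProkhorovDist (rescaledSpectralMeasure hA : Measure ℝ)
      (rescaledSpectralMeasure hB : Measure ℝ) ≤ ε := by
  refine levyProkhorovDist_le_of_forall_le _ _ hε.le fun δ s hδ hs => ?_
  have hδ0 : 0 < δ := hε.trans hδ
  have key := integral_rescaledSpectralMeasure_le hA hB (f := s.indicator 1)
    (g := (Metric.thickening δ s).indicator 1) (a := 0) (c := (δ ^ 2)⁻¹) fun x y => by
      have h0 : 0 ≤ (δ ^ 2)⁻¹ * (x - y) ^ 2 := by positivity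
      by_cases hx : x ∈ s
      · by_cases hy : y ∈ Metric.thickening δ s
        · simp only [Set.indicator_of_mem hx, Set.indicator_of_mem hy, Pi.one_apply]; linarith
        · have hxy : δ ≤ |x - y| := by
            by_contra! hlt
            exact hy (Metric.mem_thickening_iff.2 ⟨x, hx, by rwa [dist_comm, Real.dist_eq]⟩)
          simp only [Set.indicator_of_mem hx, Set.indicator_of_notMem hy, Pi.one_apply]
          rw [zero_add, zero_add, ← sq_abs (x - y), ← div_eq_inv_mul, one_le_div (by positivity)]
          gcongr
      · simp only [Set.indicator_of_notMem hx]
        have : 0 ≤ (Metric.thickening δ s).indicator (1 : ℝ → ℝ) y :=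
          Set.indicator_nonneg (fun _ _ => zero_le_one) y
        linarith
  rw [integral_indicator_one hs, integral_indicator_one Metric.isOpen_thickening.measurableSet,
    add_zero] at key
  have hle : (δ ^ 2)⁻¹ * dist (normalizedEntries A) (normalizedEntries B) ^ 2 ≤ δ := by
    rw [inv_mul_le_iff₀ (by positivity)]
    calc dist (normalizedEntries A) (normalizedEntries B) ^ 2 ≤ (ε ^ 2) ^ 2 := by gcongr
      _ = ε ^ 3 * ε := by ring
      _ ≤ ε ^ 3 * 1 := by gcongr
      _ ≤ δ ^ 2 * δ := by rw [mul_one, ← pow_succ]; gcongr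
  rw [← ofReal_measureReal, ← ofReal_measureReal (s := Metric.thickening δ s),
    ← ENNReal.ofReal_add measureReal_nonneg hδ0.le]
  exact ENNReal.ofReal_le_ofReal (key.trans (by linarith))

/-- The rescaled empirical spectral measure of `symmMatrix b`, as a function of the array `b`. -/
noncomputable def spectralMeasureOf {n : ℕ} [NeZero n] (b : Fin n → Fin n → ℝ) :
    ProbabilityMeasure ℝ :=
  rescaledSpectralMeasure (symmMatrix_isHermitian b)

theorem continuous_normalizedEntries_symmMatrix {n : ℕ} :
    Continuous fun b : Fin n → Fin n → ℝ => normalizedEntries (symmMatrix b) := by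
  refine (PiLp.continuous_toLp 2 _).comp (continuous_pi fun p => ?_)
  refine Continuous.div_const ?_ _
  simp only [symmMatrix, Matrix.of_apply]
  split_ifs <;> fun_prop

theorem continuous_spectralMeasureOf {n : ℕ} [NeZero n] :
    Continuous (spectralMeasureOf (n := n)) := by
  rw [← LevyProkhorov.probabilityMeasureHomeomorph.comp_continuous_iff, Metric.continuous_iff']
  intro b ε hε
  have hη : 0 < min (ε / 2) 1 := by positivity
  filter_upwards [Metric.continuous_iff'.1 continuous_normalizedEntries_symmMatrix b
    (min (ε / 2) 1 ^ 2) (by positivity)] with b' hb'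
  refine (levyProkhorovDist_rescaledSpectralMeasure_le (symmMatrix_isHermitian b')
    (symmMatrix_isHermitian b) hη (min_le_right _ _) hb'.le).trans_lt ?_
  exact (min_le_left _ _).trans_lt (by linarith)

/-! ### Dyadic chaining on a square -/

/-- The point `(k ℓ / 2 ^ m, l ℓ / 2 ^ m)` of the level-`m` dyadic grid of the square `[0, ℓ]²`. -/
noncomputable def gridPoint (ℓ : ℝ≥0) (m k l : ℕ) : ℝ≥0 × ℝ≥0 :=
  (k * ℓ / 2 ^ m, l * ℓ / 2 ^ m)

/-- The sum of the sixth powers of the increments of `f` from the level-`m` grid point with indices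
`q` to its right and upper neighbours. -/
noncomputable def neighborIncrement {E : Type*} [PseudoEMetricSpace E] (ℓ : ℝ≥0)
    (f : ℝ≥0 × ℝ≥0 → E) (m : ℕ) (q : ℕ × ℕ) : ℝ≥0∞ :=
  edist (f (gridPoint ℓ m q.1 q.2)) (f (gridPoint ℓ m (q.1 + 1) q.2)) ^ 6 +
    edist (f (gridPoint ℓ m q.1 q.2)) (f (gridPoint ℓ m q.1 (q.2 + 1))) ^ 6

/-- A bound for all increments of `f` along edges of the level-`m` grid. It is `c + c⁻⁵ ∑ x⁶` with
`c = (9/10) ^ m`, where `x` runs through these increments; each of them is at most `c + c⁻⁵ x⁶`. In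
this form the expectation for a random `f` is controlled by sixth moments, without taking roots. -/
noncomputable def stepBound {E : Type*} [PseudoEMetricSpace E] (ℓ : ℝ≥0) (f : ℝ≥0 × ℝ≥0 → E)
    (m : ℕ) : ℝ≥0∞ :=
  ((9 / 10 : ℝ≥0) ^ m : ℝ≥0) + ((10 / 9 : ℝ≥0) ^ (5 * m) : ℝ≥0) *
    ∑ q ∈ Finset.range (2 ^ m + 1) ×ˢ Finset.range (2 ^ m + 1), neighborIncrement ℓ f m q

section Pathwise

variable {E : Type*} [PseudoEMetricSpace E] {ℓ : ℝ≥0} {f : ℝ≥0 × ℝ≥0 → E}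

theorem le_add_pow_six_mul {c d : ℝ≥0} (hcd : d * c = 1) (x : ℝ≥0∞) :
    x ≤ c + (d ^ 5 : ℝ≥0) * x ^ 6 := by
  rcases le_total x c with h | h
  · exact h.trans le_self_add
  · have h1 : (d ^ 5 : ℝ≥0) * (c : ℝ≥0∞) ^ 5 = 1 := by
      rw [← ENNReal.coe_pow, ← ENNReal.coe_mul, ← mul_pow, hcd, one_pow, ENNReal.coe_one]
    calc x = (d ^ 5 : ℝ≥0) * (c : ℝ≥0∞) ^ 5 * x := by rw [h1, one_mul]
      _ ≤ (d ^ 5 : ℝ≥0) * x ^ 5 * x := by gcongr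
      _ = (d ^ 5 : ℝ≥0) * x ^ 6 := by ring
      _ ≤ _ := le_add_self

theorem le_stepBound_of_pow_le {m k l : ℕ} (hk : k ≤ 2 ^ m) (hl : l ≤ 2 ^ m) {x : ℝ≥0∞}
    (hx : x ^ 6 ≤ neighborIncrement ℓ f m (k, l)) : x ≤ stepBound ℓ f m := by
  have h : (10 / 9 : ℝ≥0) ^ m * (9 / 10) ^ m = 1 := by
    rw [← mul_pow, show (10 / 9 : ℝ≥0) * (9 / 10) = 1 by field_simp, one_pow]
  have hmem : (k, l) ∈ Finset.range (2 ^ m + 1) ×ˢ Finset.range (2 ^ m + 1) :=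
    Finset.mk_mem_product (Finset.mem_range_succ_iff.2 hk) (Finset.mem_range_succ_iff.2 hl)
  have hsum := hx.trans (Finset.single_le_sum (f := neighborIncrement ℓ f m)
    (fun _ _ => zero_le) hmem)
  refine (le_add_pow_six_mul h x).trans ?_
  rw [← pow_mul, mul_comm m 5]
  exact add_le_add_right (mul_le_mul_right hsum _) _

theorem edist_gridPoint_succ_left_le {m k l : ℕ} (hk : k ≤ 2 ^ m) (hl : l ≤ 2 ^ m) :
    edist (f (gridPoint ℓ m k l)) (f (gridPoint ℓ m (k + 1) l)) ≤ stepBound ℓ f m :=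
  le_stepBound_of_pow_le hk hl le_self_add

theorem edist_gridPoint_succ_right_le {m k l : ℕ} (hk : k ≤ 2 ^ m) (hl : l ≤ 2 ^ m) :
    edist (f (gridPoint ℓ m k l)) (f (gridPoint ℓ m k (l + 1))) ≤ stepBound ℓ f m :=
  le_stepBound_of_pow_le hk hl le_add_self

theorem edist_gridPoint_le {m k l k' l' : ℕ} (hk : k ≤ 2 ^ m) (hl : l ≤ 2 ^ m)
    (hk' : k' ≤ 2 ^ m) (hl' : l' ≤ 2 ^ m) (h1 : k ≤ k' + 1) (h2 : k' ≤ k + 1)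
    (h3 : l ≤ l' + 1) (h4 : l' ≤ l + 1) :
    edist (f (gridPoint ℓ m k l)) (f (gridPoint ℓ m k' l')) ≤ 2 * stepBound ℓ f m := by
  have hleft : edist (f (gridPoint ℓ m k l)) (f (gridPoint ℓ m k' l)) ≤ stepBound ℓ f m := by
    obtain rfl | rfl | rfl : k' = k ∨ k' = k + 1 ∨ k = k' + 1 := by omega
    · simp
    · exact edist_gridPoint_succ_left_le hk hl
    · rw [edist_comm]; exact edist_gridPoint_succ_left_le hk' hl
  have hright : edist (f (gridPoint ℓ m k' l)) (f (gridPoint ℓ m k' l')) ≤ stepBound ℓ f m := by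
    obtain rfl | rfl | rfl : l' = l ∨ l' = l + 1 ∨ l = l' + 1 := by omega
    · simp
    · exact edist_gridPoint_succ_right_le hk' hl
    · rw [edist_comm]; exact edist_gridPoint_succ_right_le hk' hl'
  rw [two_mul]
  exact (edist_triangle _ _ _).trans (add_le_add hleft hright)

/-- The index of the largest level-`m` grid coordinate that is at most `x`. -/
noncomputable def gridIndex (ℓ : ℝ≥0) (m : ℕ) (x : ℝ≥0) : ℕ := ⌊x * 2 ^ m / ℓ⌋₊

theorem gridIndex_le (hℓ : 0 < ℓ) {m : ℕ} {x : ℝ≥0} (hx : x ≤ ℓ) : gridIndex ℓ m x ≤ 2 ^ m := by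
  refine Nat.floor_le_of_le ?_
  rw [div_le_iff₀ hℓ]
  push_cast
  rw [mul_comm]
  gcongr

theorem gridIndex_succ (m : ℕ) (x : ℝ≥0) :
    2 * gridIndex ℓ m x ≤ gridIndex ℓ (m + 1) x ∧
      gridIndex ℓ (m + 1) x ≤ 2 * gridIndex ℓ m x + 1 := by
  have e : x * 2 ^ (m + 1) / ℓ = 2 * (x * 2 ^ m / ℓ) := by ring
  rw [gridIndex, gridIndex, e]
  set y := x * 2 ^ m / ℓ
  constructor
  · refine Nat.le_floor ?_
    push_cast
    gcongr
    exact Nat.floor_le zero_le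
  · rw [← Nat.lt_succ_iff, Nat.floor_lt zero_le]
    have := Nat.lt_floor_add_one y
    push_cast
    calc 2 * y < 2 * (⌊y⌋₊ + 1) := by gcongr
      _ = _ := by ring

theorem gridIndex_le_add_one (hℓ : 0 < ℓ) {m : ℕ} {x y : ℝ≥0} (hxy : x ≤ y + ℓ / 2 ^ m) :
    gridIndex ℓ m x ≤ gridIndex ℓ m y + 1 := by
  rw [gridIndex, gridIndex, ← Nat.floor_add_one zero_le]
  refine Nat.floor_le_floor ?_
  calc x * 2 ^ m / ℓ ≤ (y + ℓ / 2 ^ m) * 2 ^ m / ℓ := by gcongr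
    _ = y * 2 ^ m / ℓ + 1 := by field_simp

theorem tendsto_gridIndex (hℓ : 0 < ℓ) (x : ℝ≥0) :
    Tendsto (fun m => (gridIndex ℓ m x : ℝ≥0) * ℓ / 2 ^ m) atTop (𝓝 x) := by
  have h0 : Tendsto (fun m : ℕ => x - ℓ * (1 / 2 : ℝ≥0) ^ m) atTop (𝓝 x) := by
    have := (NNReal.tendsto_pow_atTop_nhds_zero_of_lt_one (r := 1 / 2) (by
      rw [div_lt_one] <;> norm_num)).const_mul ℓ
    simpa using (tendsto_const_nhds (x := x)).sub this
  refine tendsto_of_tendsto_of_tendsto_of_le_of_le h0 tendsto_const_nhds (fun m => ?_) fun m => ?_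
  · rw [tsub_le_iff_right]
    have h := (Nat.lt_floor_add_one (x * 2 ^ m / ℓ)).le
    rw [div_le_iff₀ hℓ] at h
    calc x = x * 2 ^ m / 2 ^ m := by field_simp
      _ ≤ (gridIndex ℓ m x + 1) * ℓ / 2 ^ m := by
        rw [gridIndex]
        exact div_le_div_of_nonneg_right h zero_le
      _ = _ := by rw [div_pow, one_pow]; ring
  · have h := Nat.floor_le (a := x * 2 ^ m / ℓ) zero_le
    rw [le_div_iff₀ hℓ] at h
    change (gridIndex ℓ m x : ℝ≥0) * ℓ / 2 ^ m ≤ x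
    rw [div_le_iff₀ (by positivity)]
    exact h

theorem gridPoint_eq_succ (m k l : ℕ) :
    gridPoint ℓ m k l = gridPoint ℓ (m + 1) (2 * k) (2 * l) := by
  simp only [gridPoint, Prod.mk.injEq]
  constructor <;> (push_cast; rw [pow_succ]; field_simp)

/-- Chaining: the grid points below `z` converge to `z`, and consecutive ones are at most two edges
of the finer grid apart. -/
theorem edist_le_tsum_stepBound (hℓ : 0 < ℓ) (hf : Continuous f) {z : ℝ≥0 × ℝ≥0}
    (hz : z ≤ (ℓ, ℓ)) (n : ℕ) :
    edist (f (gridPoint ℓ n (gridIndex ℓ n z.1) (gridIndex ℓ n z.2))) (f z)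
      ≤ 2 * ∑' m, stepBound ℓ f (n + m) := by
  have h := edist_le_tsum_of_edist_le_of_tendsto
    (f := fun m => f (gridPoint ℓ m (gridIndex ℓ m z.1) (gridIndex ℓ m z.2)))
    (fun m => 2 * stepBound ℓ f (m + 1)) (fun m => ?_) (a := f z) ?_ n
  · refine h.trans ?_
    rw [ENNReal.tsum_mul_left]
    exact mul_le_mul_right (ENNReal.tsum_comp_le_tsum_of_injective (add_left_injective 1)
      fun m => stepBound ℓ f (n + m)) _
  · rw [gridPoint_eq_succ]
    have h1 := gridIndex_succ (ℓ := ℓ) m z.1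
    have h2 := gridIndex_succ (ℓ := ℓ) m z.2
    have h3 := gridIndex_le hℓ (m := m) hz.1
    have h4 := gridIndex_le hℓ (m := m) hz.2
    have h5 := gridIndex_le hℓ (m := m + 1) hz.1
    have h6 := gridIndex_le hℓ (m := m + 1) hz.2
    rw [Nat.succ_eq_add_one]
    refine edist_gridPoint_le ?_ ?_ h5 h6 ?_ ?_ ?_ ?_ <;> simp only [pow_succ] at * <;> omega
  · refine (hf.tendsto z).comp ?_
    exact (tendsto_gridIndex hℓ z.1).prodMk_nhds (tendsto_gridIndex hℓ z.2)

/-- The tails of `stepBound` give a modulus of continuity on the square `[0, ℓ]²`. -/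
theorem edist_le_of_dist_le (hℓ : 0 < ℓ) (hf : Continuous f) {z w : ℝ≥0 × ℝ≥0}
    (hz : z ≤ (ℓ, ℓ)) (hw : w ≤ (ℓ, ℓ)) {n : ℕ} (hzw : dist z w ≤ ℓ / 2 ^ n) :
    edist (f z) (f w) ≤ 6 * ∑' m, stepBound ℓ f (n + m) := by
  have coord : ∀ {x y : ℝ≥0}, dist x y ≤ ℓ / 2 ^ n → x ≤ y + ℓ / 2 ^ n := fun {x y} h => by
    rw [NNReal.dist_eq] at h
    rw [← NNReal.coe_le_coe]
    push_cast
    linarith [le_abs_self ((x : ℝ) - y)]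
  have h1 : dist z.1 w.1 ≤ ℓ / 2 ^ n := (le_max_left _ _).trans hzw
  have h2 : dist z.2 w.2 ≤ ℓ / 2 ^ n := (le_max_right _ _).trans hzw
  have hmid : edist (f (gridPoint ℓ n (gridIndex ℓ n z.1) (gridIndex ℓ n z.2)))
      (f (gridPoint ℓ n (gridIndex ℓ n w.1) (gridIndex ℓ n w.2)))
      ≤ 2 * ∑' m, stepBound ℓ f (n + m) := by
    refine (edist_gridPoint_le (gridIndex_le hℓ hz.1) (gridIndex_le hℓ hz.2)
      (gridIndex_le hℓ hw.1) (gridIndex_le hℓ hw.2) (gridIndex_le_add_one hℓ (coord h1))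
      (gridIndex_le_add_one hℓ (coord (by rwa [dist_comm])))
      (gridIndex_le_add_one hℓ (coord h2))
      (gridIndex_le_add_one hℓ (coord (by rwa [dist_comm])))).trans ?_
    gcongr
    exact ENNReal.le_tsum (f := fun m => stepBound ℓ f (n + m)) 0
  have hz' := edist_le_tsum_stepBound hℓ hf hz n
  have hw' := edist_le_tsum_stepBound hℓ hf hw n
  rw [edist_comm] at hz'
  refine (edist_triangle4 _ _ _ _).trans ((add_le_add (add_le_add hz' hmid) hw').trans ?_)
  rw [← add_mul, ← add_mul]
  gcongr
  norm_num

end Pathwise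

section Expectation

variable {Ω : Type*} [MeasurableSpace Ω] {P : Measure Ω}
  {E : Type*} [PseudoEMetricSpace E] {ℓ : ℝ≥0} {F : ℝ≥0 × ℝ≥0 → Ω → E}

theorem aemeasurable_stepBound (hmeas : ∀ z w, AEMeasurable (fun ω => edist (F z ω) (F w ω)) P)
    (m : ℕ) : AEMeasurable (fun ω => stepBound ℓ (fun z => F z ω) m) P := by
  have h : AEMeasurable (fun ω => ∑ q ∈ Finset.range (2 ^ m + 1) ×ˢ Finset.range (2 ^ m + 1),
      neighborIncrement ℓ (fun z => F z ω) m q) P :=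
    Finset.aemeasurable_fun_sum _ fun q _ => ((hmeas _ _).pow_const 6).add ((hmeas _ _).pow_const 6)
  exact (h.const_mul _).const_add _

/-- Of order `4 ^ m` edges carry increments with sixth moment of order `8 ^ (-m)`, which is what a
centered Gaussian increment of variance of order `2 ^ (-m)` has. -/
theorem lintegral_stepBound_le [IsProbabilityMeasure P]
    (hmeas : ∀ z w, AEMeasurable (fun ω => edist (F z ω) (F w ω)) P)
    {C : ℝ≥0} {m : ℕ}
    (hl : ∀ k l, k ≤ 2 ^ m → l ≤ 2 ^ m → ∫⁻ ω, edist (F (gridPoint ℓ m k l) ω)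
      (F (gridPoint ℓ m (k + 1) l) ω) ^ 6 ∂P ≤ (C * (1 / 8) ^ m : ℝ≥0))
    (hr : ∀ k l, k ≤ 2 ^ m → l ≤ 2 ^ m → ∫⁻ ω, edist (F (gridPoint ℓ m k l) ω)
      (F (gridPoint ℓ m k (l + 1)) ω) ^ 6 ∂P ≤ (C * (1 / 8) ^ m : ℝ≥0)) :
    ∫⁻ ω, stepBound ℓ (fun z => F z ω) m ∂P ≤ ((1 + 8 * C) * (9 / 10) ^ m : ℝ≥0) := by
  unfold stepBound
  have hinc : ∀ q, AEMeasurable (fun ω => neighborIncrement ℓ (fun z => F z ω) m q) P :=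
    fun q => ((hmeas _ _).pow_const 6).add ((hmeas _ _).pow_const 6)
  rw [lintegral_add_left measurable_const, lintegral_const, measure_univ, mul_one,
    lintegral_const_mul' _ _ ENNReal.coe_ne_top, lintegral_finsetSum' _ fun q _ => hinc q]
  have hsum : ∑ q ∈ Finset.range (2 ^ m + 1) ×ˢ Finset.range (2 ^ m + 1),
      ∫⁻ ω, neighborIncrement ℓ (fun z => F z ω) m q ∂P
      ≤ ((2 ^ m + 1) * (2 ^ m + 1) * (2 * (C * (1 / 8) ^ m)) : ℝ≥0) := by
    refine (Finset.sum_le_card_nsmul _ _ ((2 * (C * (1 / 8) ^ m) : ℝ≥0) : ℝ≥0∞)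
      fun q hq => ?_).trans (le_of_eq ?_)
    · simp only [Finset.mem_product, Finset.mem_range] at hq
      unfold neighborIncrement
      rw [lintegral_add_left' ((hmeas _ _).pow_const 6), two_mul, ENNReal.coe_add]
      exact add_le_add (hl _ _ (by omega) (by omega)) (hr _ _ (by omega) (by omega))
    · rw [Finset.card_product, Finset.card_range, nsmul_eq_mul]
      push_cast
      ring
  refine (add_le_add_right (mul_le_mul_right hsum _) _).trans ?_
  rw [← ENNReal.coe_mul, ← ENNReal.coe_add, ENNReal.coe_le_coe, add_mul 1 (8 * C), one_mul]
  refine add_le_add_right ?_ _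
  have h1 : (1 : ℝ≥0) ≤ 2 ^ m := one_le_pow₀ (by norm_num)
  -- `(10/9) ^ 6 ≤ 2`, so the factor `(10/9) ^ (5 m)` leaves `(9/10) ^ m` out of the gain `2 ^ (-m)`.
  have h2 : (10 / 9 : ℝ≥0) ^ (5 * m) * (2 ^ m * 2 ^ m) * (1 / 8) ^ m ≤ (9 / 10) ^ m := by
    rw [pow_mul, ← mul_pow, ← mul_pow, ← mul_pow]
    refine pow_le_pow_left₀ zero_le ?_ m
    rw [← NNReal.coe_le_coe]
    push_cast
    norm_num
  calc (10 / 9 : ℝ≥0) ^ (5 * m) * ((2 ^ m + 1) * (2 ^ m + 1) * (2 * (C * (1 / 8) ^ m)))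
      ≤ (10 / 9 : ℝ≥0) ^ (5 * m) *
        ((2 ^ m + 2 ^ m) * (2 ^ m + 2 ^ m) * (2 * (C * (1 / 8) ^ m))) := by gcongr
    _ = 8 * C * ((10 / 9 : ℝ≥0) ^ (5 * m) * (2 ^ m * 2 ^ m) * (1 / 8) ^ m) := by ring
    _ ≤ _ := by gcongr

theorem lintegral_tsum_stepBound_le [IsProbabilityMeasure P]
    (hmeas : ∀ z w, AEMeasurable (fun ω => edist (F z ω) (F w ω)) P) {C : ℝ≥0}
    (hl : ∀ m k l, k ≤ 2 ^ m → l ≤ 2 ^ m → ∫⁻ ω, edist (F (gridPoint ℓ m k l) ω)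
      (F (gridPoint ℓ m (k + 1) l) ω) ^ 6 ∂P ≤ (C * (1 / 8) ^ m : ℝ≥0))
    (hr : ∀ m k l, k ≤ 2 ^ m → l ≤ 2 ^ m → ∫⁻ ω, edist (F (gridPoint ℓ m k l) ω)
      (F (gridPoint ℓ m k (l + 1)) ω) ^ 6 ∂P ≤ (C * (1 / 8) ^ m : ℝ≥0)) (n : ℕ) :
    ∫⁻ ω, ∑' m, stepBound ℓ (fun z => F z ω) (n + m) ∂P
      ≤ ((1 + 8 * C) * 10 * (9 / 10) ^ n : ℝ≥0) := by
  rw [lintegral_tsum fun m => aemeasurable_stepBound hmeas (n + m)]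
  refine (ENNReal.tsum_le_tsum fun m => lintegral_stepBound_le hmeas (hl _) (hr _)).trans ?_
  have hsum : HasSum (fun m : ℕ => (9 / 10 : ℝ≥0) ^ m) 10 := by
    have h := hasSum_geometric_of_lt_one (r := (9 / 10 : ℝ)) (by norm_num) (by norm_num)
    rw [← NNReal.hasSum_coe]
    push_cast
    convert h using 1
    norm_num
  have h := hsum.mul_left ((1 + 8 * C) * (9 / 10) ^ n)
  rw [← ENNReal.hasSum_coe] at h
  refine le_of_eq ?_
  rw [show (1 + 8 * C) * 10 * (9 / 10) ^ n = (1 + 8 * C) * (9 / 10) ^ n * 10 by ring, ← h.tsum_eq]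
  simp only [pow_add, mul_assoc]

end Expectation

/-! ### Sixth moments of Brownian sheet increments -/

/-- Scaling of the even moments of a centered Gaussian with its variance. -/
theorem lintegral_enorm_pow_gaussianReal (v : ℝ≥0) (p : ℕ) :
    ∫⁻ x, ‖x‖ₑ ^ (2 * p) ∂(gaussianReal 0 v)
      = (v : ℝ≥0∞) ^ p * ∫⁻ x, ‖x‖ₑ ^ (2 * p) ∂(gaussianReal 0 1) := by
  have h := gaussianReal_map_const_mul (μ := 0) (v := 1) (NNReal.sqrt v : ℝ)
  have e : (NNReal.mk ((NNReal.sqrt v : ℝ) ^ 2) (sq_nonneg _) * 1 : ℝ≥0) = v := by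
    rw [mul_one]; ext; push_cast; simp
  rw [mul_zero, e] at h
  rw [← h, lintegral_map (by fun_prop) (by fun_prop)]
  have hc : (‖(NNReal.sqrt v : ℝ)‖ₑ) ^ (2 * p) = (v : ℝ≥0∞) ^ p := by
    rw [pow_mul, Real.enorm_eq_ofReal (NNReal.coe_nonneg _), ENNReal.ofReal_coe_nnreal,
      ← ENNReal.coe_pow, NNReal.sq_sqrt]
  simp_rw [enorm_mul, mul_pow, hc]
  rw [lintegral_const_mul' _ _ (by finiteness)]

/-- The sixth moment of the standard normal distribution. Its value `15` is not needed. -/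
noncomputable def gaussianSixthMoment : ℝ≥0 :=
  (∫⁻ x, ‖x‖ₑ ^ 6 ∂(gaussianReal 0 1)).toNNReal

theorem coe_gaussianSixthMoment :
    (gaussianSixthMoment : ℝ≥0∞) = ∫⁻ x, ‖x‖ₑ ^ 6 ∂(gaussianReal 0 1) := by
  refine ENNReal.coe_toNNReal (ne_of_lt ?_)
  have h := (memLp_id_gaussianReal (μ := 0) (v := 1) 6).eLpNorm_lt_top
  have h' := lintegral_rpow_enorm_lt_top_of_eLpNorm_lt_top (by norm_num) (by simp) h
  simpa using h'

namespace IsBrownianSheet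

variable {Ω : Type*} [MeasurableSpace Ω] {P : Measure Ω} {B : ℝ≥0 × ℝ≥0 → Ω → ℝ}

theorem lintegral_enorm_sub_pow_six (hB : IsBrownianSheet B P) (z w : ℝ≥0 × ℝ≥0) {v : ℝ≥0}
    (hv : (z.1 : ℝ) * z.2 + w.1 * w.2 - 2 * (min (z.1 : ℝ) w.1 * min (z.2 : ℝ) w.2) = v) :
    ∫⁻ ω, ‖B z ω - B w ω‖ₑ ^ 6 ∂P = (v ^ 3 * gaussianSixthMoment : ℝ≥0) := by
  have hL : HasGaussianLaw (fun ω => B z ω - B w ω) P := hB.gaussian.hasGaussianLaw_fun_sub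
  have hz := (hB.gaussian.hasGaussianLaw_eval z).memLp_two
  have hw := (hB.gaussian.hasGaussianLaw_eval w).memLp_two
  have hmean : ∫ ω, (B z ω - B w ω) ∂P = 0 := by
    rw [integral_sub (hB.gaussian.hasGaussianLaw_eval z).integrable
      (hB.gaussian.hasGaussianLaw_eval w).integrable, hB.centered, hB.centered, sub_zero]
  have hvar : Var[fun ω => B z ω - B w ω; P] = v := by
    rw [variance_of_integral_eq_zero hL.aemeasurable hmean, ← hv]
    have e : ∀ ω, (B z ω - B w ω) ^ 2 = B z ω * B z ω + B w ω * B w ω - 2 * (B z ω * B w ω) :=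
      fun ω => by ring
    simp_rw [e]
    rw [integral_sub, integral_add, integral_const_mul, hB.covariance, hB.covariance,
      hB.covariance, min_self, min_self, min_self, min_self]
    · exact hz.integrable_mul hz
    · exact hw.integrable_mul hw
    · exact (hz.integrable_mul hz).add (hw.integrable_mul hw)
    · exact (hz.integrable_mul hw).const_mul 2
  have hmap := hL.map_eq_gaussianReal
  rw [hmean, hvar, Real.toNNReal_coe] at hmap
  rw [← lintegral_map' (f := fun x : ℝ => ‖x‖ₑ ^ 6) (by fun_prop) hL.aemeasurable, hmap,
    lintegral_enorm_pow_gaussianReal v 3, ← coe_gaussianSixthMoment]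
  push_cast
  rfl

theorem lintegral_gridPoint_succ_left (hB : IsBrownianSheet B P) {ℓ : ℝ≥0} {m k l : ℕ}
    (hl : l ≤ 2 ^ m) :
    ∫⁻ ω, ‖B (gridPoint ℓ m k l) ω - B (gridPoint ℓ m (k + 1) l) ω‖ₑ ^ 6 ∂P
      ≤ (ℓ ^ 6 * gaussianSixthMoment * (1 / 8) ^ m : ℝ≥0) := by
  have hle : (k : ℝ) * ℓ / 2 ^ m ≤ (k + 1) * ℓ / 2 ^ m := by gcongr; simp
  rw [hB.lintegral_enorm_sub_pow_six (gridPoint ℓ m k l) (gridPoint ℓ m (k + 1) l)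
    (v := ℓ / 2 ^ m * (l * ℓ / 2 ^ m))]
  · rw [ENNReal.coe_le_coe]
    have h1 : (l * ℓ / 2 ^ m : ℝ≥0) ≤ ℓ := by
      rw [div_le_iff₀ (by positivity), mul_comm]; gcongr; exact_mod_cast hl
    calc (ℓ / 2 ^ m * (l * ℓ / 2 ^ m)) ^ 3 * gaussianSixthMoment
        ≤ (ℓ / 2 ^ m * ℓ) ^ 3 * gaussianSixthMoment := by gcongr
      _ = _ := by
        rw [show (1 / 8 : ℝ≥0) = (1 / 2) ^ 3 by norm_num, ← pow_mul, mul_comm 3 m, pow_mul,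
          div_pow 1 2 m, one_pow]
        ring
  · simp only [gridPoint]
    push_cast
    rw [min_self, min_eq_left hle]
    ring

theorem lintegral_gridPoint_succ_right (hB : IsBrownianSheet B P) {ℓ : ℝ≥0} {m k l : ℕ}
    (hk : k ≤ 2 ^ m) :
    ∫⁻ ω, ‖B (gridPoint ℓ m k l) ω - B (gridPoint ℓ m k (l + 1)) ω‖ₑ ^ 6 ∂P
      ≤ (ℓ ^ 6 * gaussianSixthMoment * (1 / 8) ^ m : ℝ≥0) := by
  have hle : (l : ℝ) * ℓ / 2 ^ m ≤ (l + 1) * ℓ / 2 ^ m := by gcongr; simp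
  rw [hB.lintegral_enorm_sub_pow_six (gridPoint ℓ m k l) (gridPoint ℓ m k (l + 1))
    (v := ℓ / 2 ^ m * (k * ℓ / 2 ^ m))]
  · rw [ENNReal.coe_le_coe]
    have h1 : (k * ℓ / 2 ^ m : ℝ≥0) ≤ ℓ := by
      rw [div_le_iff₀ (by positivity), mul_comm]; gcongr; exact_mod_cast hk
    calc (ℓ / 2 ^ m * (k * ℓ / 2 ^ m)) ^ 3 * gaussianSixthMoment
        ≤ (ℓ / 2 ^ m * ℓ) ^ 3 * gaussianSixthMoment := by gcongr
      _ = _ := by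
        rw [show (1 / 8 : ℝ≥0) = (1 / 2) ^ 3 by norm_num, ← pow_mul, mul_comm 3 m, pow_mul,
          div_pow 1 2 m, one_pow]
        ring
  · simp only [gridPoint]
    push_cast
    rw [min_self, min_eq_left hle]
    ring

end IsBrownianSheet

/-! ### Measurability of continuous random fields -/

section PathMeasurability

variable {Ω : Type*} [MeasurableSpace Ω] {P : Measure Ω}
  {X : Type*} [TopologicalSpace X] [CompactSpace X] [TopologicalSpace.SeparableSpace X]
  {E : Type*} [MetricSpace E] [MeasurableSpace E] [BorelSpace E] [SecondCountableTopology E]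

theorem measurable_of_measurable_closedBall {M : Type*} [PseudoMetricSpace M]
    [SecondCountableTopology M] [MeasurableSpace M] [BorelSpace M] {F : Ω → M}
    (h : ∀ g r, MeasurableSet (F ⁻¹' Metric.closedBall g r)) : Measurable F := by
  refine measurable_of_isOpen fun U hU => ?_
  choose r hr hrU using fun g : U => Metric.nhds_basis_closedBall.mem_iff.1 (hU.mem_nhds g.2)
  obtain ⟨T, hT, hTU⟩ := TopologicalSpace.isOpen_iUnion_countable
    (fun g : U => Metric.ball (g : M) (r g)) fun _ => Metric.isOpen_ball
  have hU' : U = ⋃ g ∈ T, Metric.closedBall (g : M) (r g) := by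
    refine Set.Subset.antisymm (fun x hx => ?_) (Set.iUnion₂_subset fun g _ => hrU g)
    have : x ∈ ⋃ g : U, Metric.ball (g : M) (r g) :=
      Set.mem_iUnion.2 ⟨⟨x, hx⟩, Metric.mem_ball_self (hr _)⟩
    rw [← hTU] at this
    obtain ⟨g, hg, hxg⟩ := Set.mem_iUnion₂.1 this
    exact Set.mem_iUnion₂.2 ⟨g, hg, Metric.ball_subset_closedBall hxg⟩
  rw [hU', Set.preimage_iUnion₂]
  exact MeasurableSet.biUnion hT fun g _ => h _ _

/-- A random field with almost surely continuous paths on a compact space has a version that is a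
random element of the space of continuous maps: closed balls there are described by the values on a
countable dense set. -/
theorem exists_measurable_continuousMap [Nonempty X] [SecondCountableTopology C(X, E)]
    [MeasurableSpace C(X, E)] [BorelSpace C(X, E)] {Y : X → Ω → E}
    (hY : ∀ x, AEMeasurable (Y x) P) (hc : ∀ᵐ ω ∂P, Continuous fun x => Y x ω) :
    ∃ G : Ω → C(X, E), Measurable G ∧ ∀ᵐ ω ∂P, ∀ x, G ω x = Y x ω := by
  classical
  rcases isEmpty_or_nonempty Ω with hΩ | ⟨⟨ω₀⟩⟩
  · exact ⟨fun ω => hΩ.elim ω, measurable_of_empty _, ae_of_all _ fun ω => hΩ.elim ω⟩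
  set e := TopologicalSpace.denseSeq X
  have he : DenseRange e := TopologicalSpace.denseRange_denseSeq X
  have hgood : ∀ᵐ ω ∂P, (Continuous fun x => Y x ω) ∧
      ∀ n, Y (e n) ω = (hY (e n)).mk _ ω :=
    hc.and (ae_all_iff.2 fun n => (hY (e n)).ae_eq_mk)
  obtain ⟨N, hNsub, hNmeas, hN0⟩ := exists_measurable_superset_of_null (ae_iff.1 hgood)
  have hN : ∀ ω, ω ∉ N → (Continuous fun x => Y x ω) ∧
      ∀ n, Y (e n) ω = (hY (e n)).mk _ ω := fun ω hω => by
    by_contra h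
    exact hω (hNsub h)
  -- On the null event `N` the path is replaced by an arbitrary constant one.
  let c₀ : E := Y (e 0) ω₀
  let G : Ω → C(X, E) := fun ω =>
    if h : ω ∉ N then ⟨fun x => Y x ω, (hN ω h).1⟩ else ContinuousMap.const X c₀
  have hG : ∀ ω, ω ∉ N → ∀ x, G ω x = Y x ω := fun ω hω x => by simp [G, hω]
  have hGmeas : ∀ n, Measurable fun ω => G ω (e n) := fun n => by
    have : (fun ω => G ω (e n)) = N.piecewise (fun _ => c₀) ((hY (e n)).mk _) := by
      funext ω
      by_cases hω : ω ∈ N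
      · simp [G, hω]
      · rw [hG ω hω, Set.piecewise_eq_of_notMem _ _ _ hω, (hN ω hω).2 n]
    rw [this]
    exact Measurable.piecewise hNmeas measurable_const (hY (e n)).measurable_mk
  refine ⟨G, measurable_of_measurable_closedBall fun g r => ?_, ?_⟩
  · have : G ⁻¹' Metric.closedBall g r = ⋂ n, {ω | dist (G ω (e n)) (g (e n)) ≤ r} := by
      ext ω
      simp only [Set.mem_preimage, Metric.mem_closedBall, Set.mem_iInter, Set.mem_ofPred_eq]
      rw [ContinuousMap.dist_le_iff_of_nonempty]
      refine ⟨fun h n => h _, fun h x => ?_⟩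
      exact he.induction_on (p := fun x => dist (G ω x) (g x) ≤ r) x
        (isClosed_le (by fun_prop) continuous_const) h
    rw [this]
    exact MeasurableSet.iInter fun n =>
      measurableSet_le ((hGmeas n).dist measurable_const) measurable_const
  · filter_upwards [measure_eq_zero_iff_ae_notMem.1 hN0] with ω hω using hG ω hω

end PathMeasurability

/-! ### Compact sets of paths of measures -/

section Compactness

/-- Arzelà–Ascoli for a prescribed modulus of continuity. -/
theorem isCompact_setOf_modulus {X α : Type*} [PseudoMetricSpace X] [CompactSpace X]
    [PseudoMetricSpace α]
    {Q : Set α} (hQ : IsCompact Q) {δ : ℕ → ℝ} (hδ : ∀ k, 0 < δ k) :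
    IsCompact {g : C(X, α) | (∀ x, g x ∈ Q) ∧
      ∀ k x y, dist x y ≤ δ k → dist (g x) (g y) ≤ 1 / (k + 1 : ℝ)} := by
  refine ArzelaAscoli.isCompact_of_equicontinuous _ ?_ ?_
  · have himage : ContinuousMap.toFun '' {g : C(X, α) | (∀ x, g x ∈ Q) ∧
        ∀ k x y, dist x y ≤ δ k → dist (g x) (g y) ≤ 1 / (k + 1 : ℝ)}
        = (Set.univ.pi fun _ => Q) ∩ {g : X → α | ∀ (k : ℕ) x y, dist x y ≤ δ k →
          dist (g x) (g y) ≤ 1 / (k + 1 : ℝ)} := by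
      ext g
      constructor
      · rintro ⟨g, ⟨h1, h2⟩, rfl⟩
        exact ⟨fun x _ => h1 x, h2⟩
      · rintro ⟨h1, h2⟩
        have hcont : Continuous g := by
          rw [Metric.continuous_iff']
          intro x ε hε
          obtain ⟨k, hk⟩ := exists_nat_one_div_lt hε
          filter_upwards [Metric.closedBall_mem_nhds x (hδ k)] with y hy
          exact (h2 k y x hy).trans_lt hk
        exact ⟨⟨g, hcont⟩, ⟨fun x => h1 x trivial, h2⟩, rfl⟩
    -- The modulus condition forces continuity, so the image is closed in the product space.
    rw [himage]
    refine (isCompact_univ_pi fun _ => hQ).inter_right ?_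
    simp only [Set.ofPred_forall]
    exact isClosed_iInter fun k => isClosed_iInter fun x => isClosed_iInter fun y =>
      isClosed_iInter fun _ => isClosed_le
        ((continuous_apply x).dist (continuous_apply y)) continuous_const
  · intro x
    rw [Metric.equicontinuousAt_iff]
    intro ε hε
    obtain ⟨k, hk⟩ := exists_nat_one_div_lt hε
    exact ⟨δ k, hδ k, fun y hy g => (g.2.2 k x y (by rw [dist_comm]; exact hy.le)).trans_lt hk⟩

/-- A bound on the integral of a function tending to infinity gives tightness, by Markov's
inequality. -/
theorem isCompact_closure_setOf_integral_le {φ : ℝ → ℝ} (hφ_nonneg : ∀ x, 0 ≤ φ x)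
    (hφ_lim : Tendsto φ (cocompact ℝ) atTop) (c : ℝ) :
    IsCompact (closure {μ : ProbabilityMeasure ℝ |
      Integrable φ (μ : Measure ℝ) ∧ ∫ x, φ x ∂(μ : Measure ℝ) ≤ c}) := by
  refine isCompact_closure_of_isTightMeasureSet ?_
  rw [isTightMeasureSet_iff_exists_isCompact_measure_compl_le]
  intro ε hε
  obtain ⟨η, hη0, hηε⟩ : ∃ η : ℝ, 0 < η ∧ ENNReal.ofReal η ≤ ε := by
    rcases eq_or_ne ε ⊤ with rfl | hε'
    · exact ⟨1, one_pos, le_top⟩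
    · exact ⟨ε.toReal, ENNReal.toReal_pos hε.ne' hε', ENNReal.ofReal_toReal_le⟩
  -- Markov's inequality at the level `t = (|c| + 1) / η`.
  set t := (|c| + 1) / η with ht
  have ht0 : 0 < t := by positivity
  obtain ⟨K, hK, hKt⟩ := mem_cocompact.1 (hφ_lim.eventually_ge_atTop t)
  refine ⟨K, hK, ?_⟩
  rintro _ ⟨μ, ⟨hint, hle⟩, rfl⟩
  have hmarkov := mul_meas_ge_le_integral_of_nonneg (ae_of_all _ hφ_nonneg) hint t
  have h1 : (μ : Measure ℝ).real {x | t ≤ φ x} ≤ η := by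
    rw [← le_div_iff₀' ht0] at hmarkov
    refine hmarkov.trans ?_
    rw [div_le_iff₀ ht0, ht, mul_div_cancel₀ _ hη0.ne']
    linarith [le_abs_self c]
  refine (measure_mono hKt).trans (le_trans ?_ hηε)
  rw [← ofReal_measureReal]
  exact ENNReal.ofReal_le_ofReal h1

/-- The paths of measures that stay in the closure of `{μ | ∫ φ ∂μ ≤ c}` and move by at most
`1 / (k + 1)` in Lévy–Prokhorov distance over distances at most `δ k`, for every `k`. -/
def controlledPaths (S T : ℝ≥0) (φ : ℝ → ℝ) (c : ℝ) (δ : ℕ → ℝ) : Set (MeasurePaths S T) :=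
  {g | (∀ z, g z ∈ closure {μ : ProbabilityMeasure ℝ |
      Integrable φ (μ : Measure ℝ) ∧ ∫ x, φ x ∂(μ : Measure ℝ) ≤ c}) ∧
    ∀ (k : ℕ) z w, dist z w ≤ δ k →
      levyProkhorovDist (g z : Measure ℝ) (g w : Measure ℝ) ≤ 1 / (k + 1 : ℝ)}

/-- Arzelà–Ascoli in the Lévy–Prokhorov metric, transported to the weak topology, with Prokhorov's
theorem for the compactness of the values. -/
theorem isCompact_controlledPaths (S T : ℝ≥0) {φ : ℝ → ℝ} (hφ_nonneg : ∀ x, 0 ≤ φ x)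
    (hφ_lim : Tendsto φ (cocompact ℝ) atTop) (c : ℝ) {δ : ℕ → ℝ} (hδ : ∀ k, 0 < δ k) :
    IsCompact (controlledPaths S T φ c δ) := by
  have hQ := LevyProkhorov.probabilityMeasureHomeomorph.isCompact_image.2
    (isCompact_closure_setOf_integral_le hφ_nonneg hφ_lim c)
  have hK := (isCompact_setOf_modulus (X := Rect S T) hQ hδ).image
    (ContinuousMap.continuous_postcomp
      ⟨LevyProkhorov.toMeasure, LevyProkhorov.continuous_toMeasure_probabilityMeasure⟩)
  refine (congrArg IsCompact ?_).mpr hK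
  ext g
  constructor
  · rintro ⟨h1, h2⟩
    refine ⟨(ContinuousMap.mk LevyProkhorov.ofMeasure
      LevyProkhorov.continuous_ofMeasure_probabilityMeasure).comp g,
      ⟨fun z => Set.mem_image_of_mem _ (h1 z), h2⟩, rfl⟩
  · rintro ⟨g, ⟨h1, h2⟩, rfl⟩
    refine ⟨fun z => ?_, h2⟩
    obtain ⟨μ, hμ, hμz⟩ := h1 z
    change (g z).toMeasure ∈ _
    rw [← hμz]
    exact hμ

end Compactness

/-! ### The matrix field -/

section Sheets

theorem edist_normalizedEntries_pow_six_le {n : ℕ} [NeZero n] (A B : Matrix (Fin n) (Fin n) ℝ) :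
    edist (normalizedEntries A) (normalizedEntries B) ^ 6
      ≤ ∑ p : Fin n × Fin n, (((n : ℝ≥0) ^ 2)⁻¹ : ℝ≥0) * ‖A p.1 p.2 - B p.1 p.2‖ₑ ^ 6 := by
  have hn : (n : ℝ) ≠ 0 := by exact_mod_cast NeZero.ne n
  have hreal : dist (normalizedEntries A) (normalizedEntries B) ^ 6
      ≤ ∑ p : Fin n × Fin n, ((n : ℝ) ^ 2)⁻¹ * ‖A p.1 p.2 - B p.1 p.2‖ ^ 6 := by
    -- Jensen's inequality for the cube and the uniform average over the `n ^ 2` entries.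
    have h := Real.pow_arith_mean_le_arith_mean_pow (Finset.univ : Finset (Fin n × Fin n))
      (fun _ => ((n : ℝ) ^ 2)⁻¹) (fun p => (A p.1 p.2 - B p.1 p.2) ^ 2) (fun _ _ => by positivity)
      (by
        rw [Finset.sum_const, Finset.card_univ, Fintype.card_prod, Fintype.card_fin, nsmul_eq_mul]
        push_cast
        field_simp)
      (fun _ _ => sq_nonneg _) 3
    have e1 : dist (normalizedEntries A) (normalizedEntries B) ^ 6
        = (∑ p : Fin n × Fin n, ((n : ℝ) ^ 2)⁻¹ * (A p.1 p.2 - B p.1 p.2) ^ 2) ^ 3 := by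
      rw [show 6 = 2 * 3 by norm_num, pow_mul, dist_normalizedEntries_sq, ← Finset.mul_sum,
        Fintype.sum_prod_type, div_eq_inv_mul]
    rw [e1]
    refine h.trans (le_of_eq (Finset.sum_congr rfl fun p _ => ?_))
    rw [Real.norm_eq_abs, ← pow_mul, show 2 * 3 = 6 by norm_num, Even.pow_abs (by decide)]
  rw [edist_dist, ← ENNReal.ofReal_pow dist_nonneg]
  refine (ENNReal.ofReal_le_ofReal hreal).trans (le_of_eq ?_)
  rw [ENNReal.ofReal_sum_of_nonneg fun _ _ => by positivity]
  refine Finset.sum_congr rfl fun p _ => ?_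
  rw [ENNReal.ofReal_mul (by positivity), ENNReal.ofReal_pow (norm_nonneg _), ofReal_norm]
  congr 1
  rw [← ENNReal.ofReal_coe_nnreal]
  push_cast
  rfl

theorem enorm_symmMatrix_sub_pow_six_le {n : ℕ} (a b : Fin n → Fin n → ℝ) (i j : Fin n) :
    ‖symmMatrix a i j - symmMatrix b i j‖ₑ ^ 6
      ≤ 8 * ‖a (min i j) (max i j) - b (min i j) (max i j)‖ₑ ^ 6 := by
  by_cases hij : i = j
  · subst hij
    have h8 : ‖(√2 : ℝ)‖ₑ ^ 6 = 8 := by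
      rw [Real.enorm_eq_ofReal (Real.sqrt_nonneg _), ← ENNReal.ofReal_pow (Real.sqrt_nonneg _),
        show √2 ^ 6 = (√2 ^ 2) ^ 3 by ring, Real.sq_sqrt (by norm_num)]
      norm_num
    simp only [symmMatrix, Matrix.of_apply, if_true, min_self, max_self]
    rw [← mul_sub, enorm_mul, mul_pow, h8]
  · simp only [symmMatrix, Matrix.of_apply, if_neg hij]
    exact le_mul_of_one_le_left' (by norm_num)

theorem edist_normalizedEntries_symmMatrix_pow_six_le {n : ℕ} [NeZero n]
    (a b : Fin n → Fin n → ℝ) :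
    edist (normalizedEntries (symmMatrix a)) (normalizedEntries (symmMatrix b)) ^ 6
      ≤ ∑ p : Fin n × Fin n, (((n : ℝ≥0) ^ 2)⁻¹ * 8 : ℝ≥0) *
        ‖a (min p.1 p.2) (max p.1 p.2) - b (min p.1 p.2) (max p.1 p.2)‖ₑ ^ 6 := by
  refine (edist_normalizedEntries_pow_six_le _ _).trans (Finset.sum_le_sum fun p _ => ?_)
  rw [ENNReal.coe_mul, mul_assoc]
  exact mul_le_mul_right (enorm_symmMatrix_sub_pow_six_le a b p.1 p.2) _

theorem lintegral_sum_prod_le {Ω : Type*} [MeasurableSpace Ω] {P : Measure Ω} {n : ℕ} [NeZero n]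
    {D : Fin n × Fin n → Ω → ℝ≥0∞} (hD : ∀ p, AEMeasurable (D p) P) {c C : ℝ≥0}
    (hC : ∀ p, ∫⁻ ω, D p ω ∂P ≤ C) :
    ∫⁻ ω, ∑ p : Fin n × Fin n, (((n : ℝ≥0) ^ 2)⁻¹ * c : ℝ≥0) * D p ω ∂P ≤ (c * C : ℝ≥0) := by
  rw [lintegral_finsetSum' _ fun p _ => (hD p).const_mul _]
  calc ∑ p : Fin n × Fin n, ∫⁻ ω, (((n : ℝ≥0) ^ 2)⁻¹ * c : ℝ≥0) * D p ω ∂P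
      ≤ ∑ p : Fin n × Fin n, ((((n : ℝ≥0) ^ 2)⁻¹ * c * C : ℝ≥0) : ℝ≥0∞) :=
        Finset.sum_le_sum fun p _ => by
          rw [lintegral_const_mul' _ _ ENNReal.coe_ne_top, ENNReal.coe_mul _ C]
          exact mul_le_mul_right (hC p) _
    _ = (c * C : ℝ≥0) := by
        rw [Finset.sum_const, Finset.card_univ, Fintype.card_prod, Fintype.card_fin, nsmul_eq_mul,
          ← ENNReal.coe_natCast, ← ENNReal.coe_mul, ENNReal.coe_inj]
        have hn : (n : ℝ≥0) ≠ 0 := by exact_mod_cast NeZero.ne n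
        push_cast
        field_simp

variable {Ω : Type*} {d : ℕ+}
  {b : Fin d → Fin d → ℝ≥0 × ℝ≥0 → Ω → ℝ}

/-- The values at `z` of the upper triangular entries, reflected in the diagonal. Nothing is assumed
about `b i j` for `j < i`, and `symmMatrix` does not see these entries. -/
def reflectedEntries (b : Fin d → Fin d → ℝ≥0 × ℝ≥0 → Ω → ℝ) (z : ℝ≥0 × ℝ≥0) (ω : Ω) :
    Fin d → Fin d → ℝ :=
  fun i j => b (min i j) (max i j) z ω

theorem sheetSpectralMeasure_eq (z : ℝ≥0 × ℝ≥0) (ω : Ω) :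
    sheetSpectralMeasure b z ω = spectralMeasureOf (reflectedEntries b z ω) := by
  have h : symmMatrix (fun i j => b i j z ω) = symmMatrix (reflectedEntries b z ω) := by
    ext i j
    by_cases hij : i = j
    · subst hij; simp [symmMatrix, reflectedEntries]
    · simp [symmMatrix, reflectedEntries, hij]
  have hcongr : ∀ {A B : Matrix (Fin d) (Fin d) ℝ} (hA : A.IsHermitian) (hB : B.IsHermitian),
      A = B → rescaledSpectralMeasure hA = rescaledSpectralMeasure hB := by
    rintro A B hA hB rfl
    rfl
  exact hcongr _ _ h

/-- The matrix field `X(z) / d` as a field with values in Euclidean space. -/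
noncomputable def entryField (b : Fin d → Fin d → ℝ≥0 × ℝ≥0 → Ω → ℝ) (z : ℝ≥0 × ℝ≥0) (ω : Ω) :
    EuclideanSpace ℝ (Fin d × Fin d) :=
  normalizedEntries (symmMatrix (reflectedEntries b z ω))

variable [MeasurableSpace Ω] {P : Measure Ω}

theorem aemeasurable_reflectedEntries
    (hinit : ∀ i j : Fin d, i ≤ j → AEMeasurable (b i j 0) P)
    (hsheet : ∀ i j : Fin d, i ≤ j → IsBrownianSheet (fun z ω => b i j z ω - b i j 0 ω) P)
    (z : ℝ≥0 × ℝ≥0) : AEMeasurable (reflectedEntries b z) P := by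
  refine aemeasurable_pi_lambda _ fun i => aemeasurable_pi_lambda _ fun j => ?_
  have h := ((hsheet _ _ (min_le_max (a := i) (b := j))).gaussian.aemeasurable z).add
    (hinit _ _ (min_le_max (a := i) (b := j)))
  refine h.congr (ae_of_all _ fun ω => ?_)
  simp [reflectedEntries]

theorem ae_continuous_reflectedEntries
    (hsheet : ∀ i j : Fin d, i ≤ j → IsBrownianSheet (fun z ω => b i j z ω - b i j 0 ω) P) :
    ∀ᵐ ω ∂P, Continuous fun z => reflectedEntries b z ω := by
  have h : ∀ᵐ ω ∂P, ∀ i j : Fin d, Continuous fun z =>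
      b (min i j) (max i j) z ω - b (min i j) (max i j) 0 ω :=
    ae_all_iff.2 fun i => ae_all_iff.2 fun j => (hsheet _ _ min_le_max).continuous_paths
  filter_upwards [h] with ω hω
  refine continuous_pi fun i => continuous_pi fun j => ?_
  exact ((hω i j).add_const (b (min i j) (max i j) 0 ω)).congr fun z => sub_add_cancel _ _

/-- The increments of the normalized matrix field have, up to a constant, the sixth moments of those
of a single Brownian sheet, whatever the dimension and the joint law of the entries. -/
theorem lintegral_edist_entryField_pow_six_le
    (hsheet : ∀ i j : Fin d, i ≤ j → IsBrownianSheet (fun z ω => b i j z ω - b i j 0 ω) P)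
    {z w : ℝ≥0 × ℝ≥0} {C : ℝ≥0}
    (hC : ∀ B : ℝ≥0 × ℝ≥0 → Ω → ℝ, IsBrownianSheet B P → ∫⁻ ω, ‖B z ω - B w ω‖ₑ ^ 6 ∂P ≤ C) :
    ∫⁻ ω, edist (entryField b z ω) (entryField b w ω) ^ 6 ∂P ≤ (8 * C : ℝ≥0) := by
  let B : Fin d × Fin d → ℝ≥0 × ℝ≥0 → Ω → ℝ := fun p u ω =>
    b (min p.1 p.2) (max p.1 p.2) u ω - b (min p.1 p.2) (max p.1 p.2) 0 ω
  have hB : ∀ p, IsBrownianSheet (B p) P := fun p => hsheet _ _ min_le_max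
  have hBmeas : ∀ p, AEMeasurable (fun ω => ‖B p z ω - B p w ω‖ₑ ^ 6) P := fun p =>
    (((hB p).gaussian.aemeasurable z).sub ((hB p).gaussian.aemeasurable w)).enorm.pow_const 6
  refine le_trans (lintegral_mono fun ω => ?_) (lintegral_sum_prod_le hBmeas fun p => hC _ (hB p))
  refine (edist_normalizedEntries_symmMatrix_pow_six_le _ _).trans
    (le_of_eq (Finset.sum_congr rfl fun p _ => ?_))
  have hmin : min (min p.1 p.2) (max p.1 p.2) = min p.1 p.2 := min_eq_left min_le_max
  have hmax : max (min p.1 p.2) (max p.1 p.2) = max p.1 p.2 := max_eq_right min_le_max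
  simp only [reflectedEntries, B, sub_sub_sub_cancel_right, hmin, hmax]

theorem aemeasurable_edist_entryField
    (hinit : ∀ i j : Fin d, i ≤ j → AEMeasurable (b i j 0) P)
    (hsheet : ∀ i j : Fin d, i ≤ j → IsBrownianSheet (fun z ω => b i j z ω - b i j 0 ω) P)
    (z w : ℝ≥0 × ℝ≥0) :
    AEMeasurable (fun ω => edist (entryField b z ω) (entryField b w ω)) P :=
  (continuous_normalizedEntries_symmMatrix.measurable.comp_aemeasurable
    (aemeasurable_reflectedEntries hinit hsheet z)).edist
  (continuous_normalizedEntries_symmMatrix.measurable.comp_aemeasurable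
    (aemeasurable_reflectedEntries hinit hsheet w))

/-- The constant in the chaining bound on `[0, ℓ]²`; it does not depend on the dimension `d`. -/
noncomputable def chainingConstant (ℓ : ℝ≥0) : ℝ≥0 :=
  (1 + 8 * (8 * (ℓ ^ 6 * gaussianSixthMoment))) * 10

theorem lintegral_tsum_stepBound_entryField_le [IsProbabilityMeasure P]
    (hinit : ∀ i j : Fin d, i ≤ j → AEMeasurable (b i j 0) P)
    (hsheet : ∀ i j : Fin d, i ≤ j → IsBrownianSheet (fun z ω => b i j z ω - b i j 0 ω) P)
    (ℓ : ℝ≥0) (n : ℕ) :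
    ∫⁻ ω, ∑' m, stepBound ℓ (fun z => entryField b z ω) (n + m) ∂P
      ≤ (chainingConstant ℓ * (9 / 10) ^ n : ℝ≥0) := by
  refine lintegral_tsum_stepBound_le (C := 8 * (ℓ ^ 6 * gaussianSixthMoment))
    (aemeasurable_edist_entryField hinit hsheet) (fun m k l hk hl => ?_) (fun m k l hk hl => ?_) n
  · rw [mul_assoc]
    exact lintegral_edist_entryField_pow_six_le hsheet fun B hB =>
      hB.lintegral_gridPoint_succ_left hl
  · rw [mul_assoc]
    exact lintegral_edist_entryField_pow_six_le hsheet fun B hB =>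
      hB.lintegral_gridPoint_succ_right hk

theorem exists_measurable_measurePath (S T : ℝ≥0)
    (hinit : ∀ i j : Fin d, i ≤ j → AEMeasurable (b i j 0) P)
    (hsheet : ∀ i j : Fin d, i ≤ j → IsBrownianSheet (fun z ω => b i j z ω - b i j 0 ω) P) :
    ∃ 𝓛 : Ω → MeasurePaths S T, Measurable 𝓛 ∧
      ∀ᵐ ω ∂P, ∀ z : Rect S T, 𝓛 ω z = sheetSpectralMeasure b z ω := by
  borelize C(Rect S T, Fin d → Fin d → ℝ)
  have : Nonempty (Rect S T) := ⟨⟨0, le_rfl, zero_le⟩⟩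
  obtain ⟨G, hG, hGω⟩ := exists_measurable_continuousMap (P := P) (X := Rect S T)
    (Y := fun z ω => reflectedEntries b z ω)
    (fun z => aemeasurable_reflectedEntries hinit hsheet z)
    ((ae_continuous_reflectedEntries hsheet).mono fun ω hω => hω.comp continuous_subtype_val)
  refine ⟨fun ω => (ContinuousMap.mk _ continuous_spectralMeasureOf).comp (G ω),
    (ContinuousMap.continuous_postcomp _).measurable.comp hG, ?_⟩
  filter_upwards [hGω] with ω hω z
  rw [sheetSpectralMeasure_eq]
  exact congrArg spectralMeasureOf (hω z)

end Sheets

/-! ### Tightness -/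

theorem continuous_integral_spectralMeasureOf {n : ℕ} [NeZero n] {φ : ℝ → ℝ} {C : ℝ≥0}
    (hφ : LipschitzWith C φ) :
    Continuous fun b : Fin n → Fin n → ℝ => ∫ x, φ x ∂(spectralMeasureOf b : Measure ℝ) := by
  have hlip : ∀ a b : Fin n → Fin n → ℝ,
      dist (∫ x, φ x ∂(spectralMeasureOf a : Measure ℝ))
        (∫ x, φ x ∂(spectralMeasureOf b : Measure ℝ))
      ≤ C * dist (normalizedEntries (symmMatrix a)) (normalizedEntries (symmMatrix b)) :=
    fun a b => by
      have h1 := integral_rescaledSpectralMeasure_le_of_lipschitzWith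
        (symmMatrix_isHermitian a) (symmMatrix_isHermitian b) hφ
      have h2 := integral_rescaledSpectralMeasure_le_of_lipschitzWith
        (symmMatrix_isHermitian b) (symmMatrix_isHermitian a) hφ
      rw [dist_comm] at h2
      rw [Real.dist_eq, abs_sub_le_iff]
      exact ⟨sub_le_iff_le_add'.2 h1, sub_le_iff_le_add'.2 h2⟩
  rw [continuous_iff_continuousAt]
  intro b
  rw [ContinuousAt, tendsto_iff_dist_tendsto_zero]
  refine squeeze_zero (fun _ => dist_nonneg) (fun a => hlip a b) ?_
  have hc : Continuous fun a : Fin n → Fin n → ℝ =>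
      (C : ℝ) * dist (normalizedEntries (symmMatrix a)) (normalizedEntries (symmMatrix b)) :=
    continuous_const.mul (continuous_normalizedEntries_symmMatrix.dist continuous_const)
  exact hc.tendsto' _ _ (by simp)

/-- An almost surely finite supremum of countably many random variables is bounded in probability. -/
theorem exists_measure_not_forall_le {Ω ι : Type*} [MeasurableSpace Ω] [Countable ι]
    {P : Measure Ω} [IsFiniteMeasure P] {I : ι → Ω → ℝ} (hI : ∀ i, AEMeasurable (I i) P)
    (hbdd : ∀ᵐ ω ∂P, BddAbove (Set.range fun i => I i ω)) {ε : ℝ≥0∞} (hε : 0 < ε) :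
    ∃ M : ℕ, P {ω | ¬ ∀ i, I i ω ≤ M} ≤ ε := by
  have hnull : ∀ M : ℕ, NullMeasurableSet {ω | ¬ ∀ i, I i ω ≤ M} P := fun M => by
    have : {ω | ∀ i, I i ω ≤ M} = ⋂ i, {ω | I i ω ≤ M} := by
      ext ω; simp
    have h : NullMeasurableSet {ω | ∀ i, I i ω ≤ M} P := by
      rw [this]
      exact NullMeasurableSet.iInter fun i => nullMeasurableSet_le (hI i) aemeasurable_const
    exact h.compl
  have hanti : Antitone fun M : ℕ => {ω | ¬ ∀ i, I i ω ≤ M} := fun M N hMN ω hω h =>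
    hω fun i => (h i).trans (by exact_mod_cast hMN)
  have hzero : P (⋂ M : ℕ, {ω | ¬ ∀ i, I i ω ≤ M}) = 0 := by
    refine measure_mono_null (fun ω hω => ?_) (ae_iff.1 hbdd)
    rintro ⟨B, hB⟩
    obtain ⟨M, hM⟩ := exists_nat_ge B
    exact Set.mem_iInter.1 hω M fun i => (hB ⟨i, rfl⟩).trans hM
  have htend := tendsto_measure_iInter_atTop hnull hanti ⟨0, measure_ne_top _ _⟩
  rw [hzero] at htend
  obtain ⟨M, hM⟩ := (htend.eventually (ge_mem_nhds hε)).exists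
  exact ⟨M, hM⟩

/-- The deterministic part of the tightness proof: a bound on `∫ φ` at the origin and bounds on the
tails of the chaining series put the path of spectral measures into `controlledPaths`. -/
theorem mem_controlledPaths {Ω : Type*} {d : ℕ+} {b : Fin d → Fin d → ℝ≥0 × ℝ≥0 → Ω → ℝ}
    {S T ℓ : ℝ≥0} (hℓ : 0 < ℓ) (hSℓ : S ≤ ℓ) (hTℓ : T ≤ ℓ) {φ : ℝ → ℝ} {C : ℝ≥0}
    (hφ : LipschitzWith C φ) {ω : Ω} (hcont : Continuous fun z => reflectedEntries b z ω)
    {M A : ℝ} (hM : ∫ x, φ x ∂(sheetSpectralMeasure b 0 ω : Measure ℝ) ≤ M) (hA0 : 0 ≤ A)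
    (hA : 6 * ∑' m, stepBound ℓ (fun z => entryField b z ω) (0 + m) ≤ ENNReal.ofReal A)
    {n : ℕ → ℕ} (hn : ∀ k : ℕ, 6 * ∑' m, stepBound ℓ (fun z => entryField b z ω) (n k + m)
      ≤ ENNReal.ofReal ((1 / (k + 1 : ℝ)) ^ 2))
    {g : MeasurePaths S T} (hg : ∀ z : Rect S T, g z = sheetSpectralMeasure b z ω) :
    g ∈ controlledPaths S T φ (M + C * A) (fun k => ℓ / 2 ^ n k) := by
  have hfield : Continuous fun z => entryField b z ω :=
    continuous_normalizedEntries_symmMatrix.comp hcont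
  have hmem : ∀ z : Rect S T, (z : ℝ≥0 × ℝ≥0) ≤ (ℓ, ℓ) := fun z =>
    z.2.2.trans ⟨hSℓ, hTℓ⟩
  have h0 : (0 : ℝ≥0 × ℝ≥0) ≤ (ℓ, ℓ) := ⟨zero_le, zero_le⟩
  refine ⟨fun z => subset_closure ⟨?_, ?_⟩, fun k z w hzw => ?_⟩
  · rw [hg]
    exact integrable_rescaledSpectralMeasure _ φ
  · rw [hg, sheetSpectralMeasure_eq]
    rw [sheetSpectralMeasure_eq] at hM
    have hdist : dist (z : ℝ≥0 × ℝ≥0) 0 ≤ ℓ / 2 ^ 0 := by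
      rw [pow_zero, div_one, Prod.dist_eq, NNReal.dist_eq, NNReal.dist_eq]
      have h1 : ((z : ℝ≥0 × ℝ≥0).1 : ℝ) ≤ ℓ := by exact_mod_cast (hmem z).1
      have h2 : ((z : ℝ≥0 × ℝ≥0).2 : ℝ) ≤ ℓ := by exact_mod_cast (hmem z).2
      simpa using ⟨h1, h2⟩
    have hA' := (edist_le_of_dist_le hℓ hfield (hmem z) h0 hdist).trans hA
    rw [edist_dist, ENNReal.ofReal_le_ofReal_iff hA0] at hA'
    have h := integral_rescaledSpectralMeasure_le_of_lipschitzWith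
      (symmMatrix_isHermitian (reflectedEntries b z ω))
      (symmMatrix_isHermitian (reflectedEntries b 0 ω)) hφ
    exact h.trans (add_le_add hM (mul_le_mul_of_nonneg_left hA' C.coe_nonneg))
  · have hk := (edist_le_of_dist_le hℓ hfield (hmem z) (hmem w) hzw).trans (hn k)
    rw [edist_dist, ENNReal.ofReal_le_ofReal_iff (by positivity)] at hk
    rw [hg, hg, sheetSpectralMeasure_eq, sheetSpectralMeasure_eq]
    refine levyProkhorovDist_rescaledSpectralMeasure_le _ _ (by positivity) ?_ hk
    rw [div_le_one (by positivity)]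
    linarith [(Nat.cast_nonneg k : (0 : ℝ) ≤ k)]

theorem measure_lt_six_mul_le {Ω : Type*} [MeasurableSpace Ω] {P : Measure Ω}
    {U : Ω → ℝ≥0∞} (hU : AEMeasurable U P) {K : ℝ≥0} (hK : ∫⁻ ω, U ω ∂P ≤ K) {a : ℝ}
    (ha : 0 < a) :
    P {ω | ENNReal.ofReal a < 6 * U ω} ≤ 6 * K / ENNReal.ofReal a := by
  have h := meas_ge_le_lintegral_div (hU.const_mul 6) (ε := ENNReal.ofReal a)
    (by simpa using ha) ENNReal.ofReal_ne_top
  rw [lintegral_const_mul' _ _ (by simp)] at h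
  exact (measure_mono fun ω hω => le_of_lt (α := ℝ≥0∞) hω).trans (h.trans (by gcongr))

/-- Here `X^d` is built from `b d i j`, `i ≤ j`, each of which is a (possibly random) initial value
`b d i j 0` plus a standard Brownian sheet, and `sheetSpectralMeasure (b d) z ω` is `L_d(z)(ω)`.
The conclusion says that `L_d` is, up to a null event, a random element `𝓛 d` of
`C([0,S] × [0,T], 𝓟(ℝ))` and that the laws of these random elements form a tight family. -/
theorem theorem4p3 {Ω : Type*} [MeasurableSpace Ω] (P : Measure Ω) [IsProbabilityMeasure P]
    (S T : ℝ≥0) (hS : 0 < S) (hT : 0 < T)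
    (b : (d : ℕ+) → Fin d → Fin d → ℝ≥0 × ℝ≥0 → Ω → ℝ)
    (hinit : ∀ (d : ℕ+) (i j : Fin d), i ≤ j → AEMeasurable (b d i j 0) P)
    (hsheet : ∀ (d : ℕ+) (i j : Fin d), i ≤ j →
      IsBrownianSheet (fun z ω => b d i j z ω - b d i j 0 ω) P)
    (hindep : ∀ d : ℕ+, iIndepFun
      (fun (p : {p : Fin d × Fin d // p.1 ≤ p.2}) (ω : Ω) (z : ℝ≥0 × ℝ≥0) =>
        b d p.1.1 p.1.2 z ω - b d p.1.1 p.1.2 0 ω) P)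
    (φ : ℝ → ℝ) (hφ_nonneg : ∀ x, 0 ≤ φ x) (hφ_C1 : ContDiff ℝ 1 φ)
    (hφ_deriv : ∃ C : ℝ, ∀ x, |deriv φ x| ≤ C)
    (hφ_lim : Tendsto φ (cocompact ℝ) atTop)
    (hφ_init : ∀ᵐ ω ∂P, BddAbove (Set.range fun d : ℕ+ =>
      ∫ x, φ x ∂(sheetSpectralMeasure (b d) 0 ω : Measure ℝ))) :
    ∃ 𝓛 : ℕ+ → Ω → MeasurePaths S T,
      (∀ d, Measurable (𝓛 d)) ∧
      (∀ d, ∀ᵐ ω ∂P, ∀ z : Rect S T, 𝓛 d ω z = sheetSpectralMeasure (b d) z ω) ∧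
      IsTightMeasureSet (Set.range fun d : ℕ+ => P.map (𝓛 d)) := by
  choose 𝓛 h𝓛 h𝓛_eq using fun d => exists_measurable_measurePath S T (hinit d) (hsheet d)
  refine ⟨𝓛, h𝓛, h𝓛_eq, ?_⟩
  obtain ⟨C, hC⟩ := hφ_deriv
  have hφ_lip : LipschitzWith C.toNNReal φ :=
    lipschitzWith_of_nnnorm_deriv_le (hφ_C1.differentiable (by norm_num)) fun x => by
      rw [← NNReal.coe_le_coe, coe_nnnorm, Real.norm_eq_abs]
      exact (hC x).trans (Real.le_coe_toNNReal C)
  rw [isTightMeasureSet_iff_exists_isCompact_measure_compl_le]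
  intro ε hε
  set ℓ := max S T with hℓ_def
  have hℓ : 0 < ℓ := hS.trans_le (le_max_left _ _)
  set U : ℕ+ → ℕ → Ω → ℝ≥0∞ := fun d n ω =>
    ∑' m, stepBound ℓ (fun z => entryField (b d) z ω) (n + m) with hU
  have hUmeas : ∀ d n, AEMeasurable (U d n) P := fun d n => AEMeasurable.tsum fun m =>
    aemeasurable_stepBound (aemeasurable_edist_entryField (hinit d) (hsheet d)) (n + m)
  have hUint : ∀ d n, ∫⁻ ω, U d n ω ∂P ≤ (chainingConstant ℓ * (9 / 10) ^ n : ℝ≥0) := fun d n =>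
    lintegral_tsum_stepBound_entryField_le (hinit d) (hsheet d) ℓ n
  have hε3 : 0 < ε / 3 := ENNReal.div_pos hε.ne' (by norm_num)
  -- `M` controls the initial measures, `A` the total oscillation of the matrix fields.
  obtain ⟨M, hM⟩ := exists_measure_not_forall_le (P := P)
    (I := fun (d : ℕ+) ω => ∫ x, φ x ∂(sheetSpectralMeasure (b d) 0 ω : Measure ℝ))
    (fun d => by
      simp_rw [sheetSpectralMeasure_eq]
      exact (continuous_integral_spectralMeasureOf hφ_lip).measurable.comp_aemeasurable
        (aemeasurable_reflectedEntries (hinit d) (hsheet d) 0)) hφ_init hε3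
  obtain ⟨A, hA0, hA⟩ : ∃ A : ℝ, 0 < A ∧ ∀ d, P {ω | ENNReal.ofReal A < 6 * U d 0 ω} ≤ ε / 3 := by
    have htend : Tendsto (fun A : ℝ => 6 * (chainingConstant ℓ * (9 / 10) ^ 0 : ℝ≥0)
        / ENNReal.ofReal A) atTop (𝓝 0) :=
      ENNReal.Tendsto.const_div ENNReal.tendsto_ofReal_atTop (Or.inr (by finiteness)) |>.trans
        (by simp)
    obtain ⟨A, hA, hA0⟩ := ((htend.eventually (ge_mem_nhds hε3)).and (eventually_gt_atTop 0)).exists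
    exact ⟨A, hA0, fun d => (measure_lt_six_mul_le (hUmeas d 0) (hUint d 0) hA0).trans hA⟩
  obtain ⟨η, hη0, hη⟩ := ENNReal.exists_pos_sum_of_countable' hε3.ne' ℕ
  -- The threshold is a square because Lévy–Prokhorov distance `ε` costs matrix distance `ε ^ 2`.
  have hn : ∀ k : ℕ, ∃ n : ℕ, ∀ d,
      P {ω | ENNReal.ofReal ((1 / (k + 1 : ℝ)) ^ 2) < 6 * U d n ω} ≤ η k := fun k => by
    have ha : 0 < (1 / (k + 1 : ℝ)) ^ 2 := by positivity
    have htend : Tendsto (fun n : ℕ => 6 * (chainingConstant ℓ * (9 / 10) ^ n : ℝ≥0)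
        / ENNReal.ofReal ((1 / (k + 1 : ℝ)) ^ 2)) atTop (𝓝 0) := by
      have h1 : Tendsto (fun n : ℕ => chainingConstant ℓ * (9 / 10 : ℝ≥0) ^ n) atTop (𝓝 0) := by
        simpa using (NNReal.tendsto_pow_atTop_nhds_zero_of_lt_one (r := 9 / 10)
          (by rw [div_lt_one] <;> norm_num)).const_mul (chainingConstant ℓ)
      have h2 := ENNReal.Tendsto.div_const (ENNReal.Tendsto.const_mul (a := 6)
        (ENNReal.tendsto_coe.2 h1) (Or.inr (by simp)))
        (b := ENNReal.ofReal ((1 / (k + 1 : ℝ)) ^ 2)) (Or.inr (by simpa using ha.ne'))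
      simpa using h2
    obtain ⟨n, hn⟩ := (htend.eventually (ge_mem_nhds (hη0 k))).exists
    exact ⟨n, fun d => (measure_lt_six_mul_le (hUmeas d n) (hUint d n) ha).trans hn⟩
  choose n hn using hn
  have hK := isCompact_controlledPaths S T hφ_nonneg hφ_lim (M + C.toNNReal * A)
    (δ := fun k => ℓ / 2 ^ n k) fun k => by positivity
  refine ⟨_, hK, ?_⟩
  rintro _ ⟨d, rfl⟩
  rw [Measure.map_apply (h𝓛 d) hK.isClosed.measurableSet.compl]
  set N : Set Ω := {ω | ¬((∀ z : Rect S T, 𝓛 d ω z = sheetSpectralMeasure (b d) z ω) ∧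
    Continuous fun z => reflectedEntries (b d) z ω)} with hN
  have hN0 : P N = 0 := ae_iff.1 ((h𝓛_eq d).and (ae_continuous_reflectedEntries (hsheet d)))
  have hsub : 𝓛 d ⁻¹' (controlledPaths S T φ (M + C.toNNReal * A) fun k => ℓ / 2 ^ n k)ᶜ
      ⊆ N ∪ ({ω | ¬ ∀ d : ℕ+, ∫ x, φ x ∂(sheetSpectralMeasure (b d) 0 ω : Measure ℝ) ≤ M} ∪
        ({ω | ENNReal.ofReal A < 6 * U d 0 ω} ∪
          ⋃ k : ℕ, {ω | ENNReal.ofReal ((1 / (k + 1 : ℝ)) ^ 2) < 6 * U d (n k) ω})) := by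
    intro ω hω
    by_contra hgood
    simp only [Set.mem_union, Set.mem_iUnion, not_or, not_exists] at hgood
    obtain ⟨h1, h2, h3, h4⟩ := hgood
    obtain ⟨h1, h1'⟩ := not_not.1 h1
    exact hω (mem_controlledPaths hℓ (le_max_left _ _) (le_max_right _ _) hφ_lip h1'
      (not_not.1 h2 d) hA0.le (not_lt.1 h3) (fun k => not_lt.1 (h4 k)) h1)
  calc P (𝓛 d ⁻¹' (controlledPaths S T φ (M + C.toNNReal * A) fun k => ℓ / 2 ^ n k)ᶜ)
      ≤ 0 + (ε / 3 + (ε / 3 + ∑' k, η k)) := by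
        refine (measure_mono hsub).trans ((measure_union_le _ _).trans
          (add_le_add hN0.le ((measure_union_le _ _).trans (add_le_add hM
            ((measure_union_le _ _).trans (add_le_add (hA d) ?_))))))
        exact (measure_iUnion_le _).trans (ENNReal.tsum_le_tsum fun k => hn k d)
    _ ≤ 0 + (ε / 3 + (ε / 3 + ε / 3)) := by gcongr
    _ = ε := by rw [zero_add, ← add_assoc, ENNReal.add_thirds]
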